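/- Let $n\ge 1$, let $\mu$ be Lebesgue measure on $\mathbb R^n$, $\operatorname{ci}(A)$ the closure of the interior of $A$, and $d_\mu(A,B)=\mu(A\,\Delta\,B)$. Let $\mathfrak L_n$ be the collection of Lebesgue measurable sets of finite measure, and $\mathfrak J_n$ the collection of bounded sets $A\subset\mathbb R^n$ with $A=\operatorname{ci}(A)$ and $\mu(\partial A)=0$ (including $\emptyset$). **Distance average.** For $A\ne\emptyset$ let $d_S(p,A)=d(p,\partial A)$ if $p\in A$ and $-d(p,\partial A)$ if $p\notin A$. For nonempty $A,B$ and $x\in\mathbb R$ put $f_{A,B,x}(p)=x\,d_S(p,A)+(1-x)\,d_S(p,B)$ and $x A\,\widetilde\oplus\,(1-x)B=\{p: f_{A,B,x}(p)\ge 0\}$. If exactly one of the two sets is empty, its signed distance is replaced by $-\|p-q\|$, where $q$ is a chosen point at which the signed distance to the other set is maximal; the average of two empty sets is empty. **Measure average.** For real $t$ the set $tA\oplus(1-t)B$ is built in three steps; only $t\in[0,1]$ occurs below, and we describe this case. 1. Let $B\subset A$, where $A\setminus B$ is treated as a single component. If $\mu\{f_{A,B,1/2}=0\}=0$, then $tA\oplus(1-t)B=\operatorname{ci}\bigl(gA\,\widetilde\oplus\,(1-g)B\bigr)$,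 where $g=g(t)$ is any minimizer over $\xi\in[-N,N]$ (with $N\ge1$ a fixed bound) of $\bigl|\mu(\xi A\,\widetilde\oplus\,(1-\xi)B)-(t\mu(A)+(1-t)\mu(B))\bigr|$. Otherwise $tA\oplus(1-t)B=\operatorname{ci}(\{p:d(p,B)\le r\}\cap A)$, where $r\ge0$ is any number with $\mu(\{p:d(p,B)\le r\}\cap A)=t\mu(A)+(1-t)\mu(B)$. 2. Let $B\subseteq A$ in $\mathfrak J_n$. If $A=B$, then $tA\oplus(1-t)B=A$. Otherwise $tA\oplus(1-t)B=\bigcup_C \bigl(t(B\cup C)\oplus(1-t)B\bigr)$, the averages on the right being those of step 1 and $C$ running over the connected components of $A\setminus B$; if there are infinitely many of these, those of measure less than a chosen $\varepsilon>0$ are replaced by their union, taken as one $C$. 3. For arbitrary $A,B\in\mathfrak J_n$, with $D=\operatorname{ci}(A\cap B)$, $tA\oplus(1-t)B=\bigl(tA\oplus(1-t)D\bigr)\cup\bigl((1-t)B\oplus tD\bigr)$. **Set-valued scheme of degree $m\ge1$.** Given $(F_i^0)_{i\in\mathbb Z}\subset\mathfrak J_n$, for $k\ge0$ and $i\in\mathbb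 Z$ let $F_{2i}^{k+1,0}=F_i^k$ and $F_{2i+1}^{k+1,0}=\frac12F_i^k\oplus\frac12F_{i+1}^k$; for $1\le j\le m-1$ let $F_i^{k+1,j}=\frac12F_i^{k+1,j-1}\oplus\frac12F_{i+1}^{k+1,j-1}$; and let $F_i^{k+1}=F^{k+1,m-1}_{i-\lfloor (m-1)/2\rfloor}$. Put $F_k(x)=\lambda F_i^k\oplus(1-\lambda)F_{i+1}^k$ for $i2^{-k}\le x<(i+1)2^{-k}$, $\lambda=i+1-2^kx$. A limit of the scheme is a map $F^\infty:\mathbb R\to\mathfrak L_n$ with $d_\mu(F_k(x),F^\infty(x))\to0$ for every $x\in\mathbb R$. **Real-valued scheme of degree $m$.** Given $(f_i^0)_{i\in\mathbb Z}\subset\mathbb R$, let $f_i^{k+1}=\sum_{j\in\mathbb Z}a^{(m)}_{\lceil (m+1)/2\rceil+i-2j}f_j^k$, where $a^{(m)}_l=\binom{m+1}{l}/2^m$ for $0\le l\le m+1$ and $a_l^{(m)}=0$ otherwise. Let $f_k$ be the piecewise linear interpolant of the data $(2^{-k}i,f_i^k)$; the limit $f^\infty$ is the pointwise limit of $f_k$.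 **Corollary.** Let $n,m\ge1$ and $(F_i^0)_{i\in\mathbb Z}\subset\mathfrak J_n$, and fix any admissible selection of the free choices ($q$, $N$, $g$, $r$, $\varepsilon$) in the measure average. Then the set-valued scheme applied to $(F_i^0)$ has a limit $F^\infty$, the real-valued scheme applied to $(\mu(F_i^0))_{i\in\mathbb Z}$ has a limit $f^\infty$, and for every such $F^\infty$ and $f^\infty$, $$\mu\bigl(F^\infty(x)\bigr)=f^\infty(x)\qquad\text{for all }x\in\mathbb R .$$ -/

import Mathlib

namespace SetSpline

open MeasureTheory

/-- Euclidean space of dimension `n`. -/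
abbrev E (n : ℕ) : Type := EuclideanSpace ℝ (Fin n)

/-- Lebesgue measurable subsets of `ℝⁿ` of finite measure. -/
def LebesgueFinite {n : ℕ} (A : Set (E n)) : Prop :=
  NullMeasurableSet A (volume : Measure (E n)) ∧ volume A < ⊤

/-- The symmetric difference (pseudo)metric. -/
noncomputable def dMu {n : ℕ} (A B : Set (E n)) : ENNReal :=
  volume ((A \ B) ∪ (B \ A))

/-- The closure of the interior. -/
def ci {n : ℕ} (A : Set (E n)) : Set (E n) := closure (interior A)

/-- Regular compact Jordan measurable sets: bounded, equal to the closure of their interior, and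
with boundary of measure zero (the empty set is one of them). -/
def RegularJordan {n : ℕ} (A : Set (E n)) : Prop :=
  Bornology.IsBounded A ∧ A = ci A ∧ volume (frontier A) = 0

open scoped Classical in
/-- Signed distance from `p` to `A`: the distance to the boundary of `A`, positive inside. -/
noncomputable def signedDist {n : ℕ} (p : E n) (A : Set (E n)) : ℝ :=
  if p ∈ A then Metric.infDist p (frontier A) else -Metric.infDist p (frontier A)

/-- `q` is a deepest point of `A`. -/
def IsCenter {n : ℕ} (A : Set (E n)) (q : E n) : Prop :=
  IsLUB ((fun a => signedDist a A) '' A) (signedDist q A)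

open scoped Classical in
/-- The signed distance to `A` as it enters the average of `A` with `B`: if `A` is empty it is
replaced by `-‖p - q‖`, where `q` is the chosen center of `B`. -/
noncomputable def relSignedDist {n : ℕ} (center : Set (E n) → E n) (p : E n)
    (A B : Set (E n)) : ℝ :=
  if A = ∅ then -‖p - center B‖ else signedDist p A

/-- `x d_S(p, A) + (1 - x) d_S(p, B)`. -/
noncomputable def levelFun {n : ℕ} (center : Set (E n) → E n) (A B : Set (E n)) (x : ℝ)
    (p : E n) : ℝ :=
  x * relSignedDist center p A B + (1 - x) * relSignedDist center p B A

open scoped Classical in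
/-- The distance average of `A` and `B` with parameter `x`. -/
noncomputable def distanceAverage {n : ℕ} (center : Set (E n) → E n) (x : ℝ)
    (A B : Set (E n)) : Set (E n) :=
  if A = ∅ ∧ B = ∅ then ∅ else {p | 0 ≤ levelFun center A B x p}

/-- The zero-measure condition. -/
def ZeroMeasureCondition {n : ℕ} (center : Set (E n) → E n) (A B : Set (E n)) : Prop :=
  volume {p | levelFun center A B (1 / 2) p = 0} = 0

/-- The minimizers over `[-N, N]` of
`ξ ↦ |μ(distance average at ξ) - (t μ(A) + (1 - t) μ(B))|`. -/
def reparamSet {n : ℕ} (center : Set (E n) → E n) (N t : ℝ) (A B : Set (E n)) : Set ℝ :=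
  {x | x ∈ Set.Icc (-N) N ∧
    IsMinOn (fun ξ : ℝ => |volume.real (distanceAverage center ξ A B)
      - (t * volume.real A + (1 - t) * volume.real B)|) (Set.Icc (-N) N) x}

/-- The `r`-offset of `B`. -/
def offset {n : ℕ} (B : Set (E n)) (r : ℝ) : Set (E n) := {p | Metric.infDist p B ≤ r}

/-- The radii `r` for which `O(B, r) ∩ A` has measure `t μ(A) + (1 - t) μ(B)`. -/
def radiusSet {n : ℕ} (t : ℝ) (A B : Set (E n)) : Set ℝ :=
  {r | 0 ≤ r ∧ volume.real (offset B r ∩ A) = t * volume.real A + (1 - t) * volume.real B}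

/-- The free choices in the construction of the measure average: deepest points, the bound `N`, the
reparametrization, the offset radius, and the size below which connected components are lumped
together. The specifications only ask that a member be selected from each set of candidates that
has one, so they are satisfiable for trivial reasons; that the candidates exist is not assumed. -/
structure AverageChoices (n : ℕ) where
  center : Set (E n) → E n
  center_spec : ∀ A, (∃ q, IsCenter A q) → IsCenter A (center A)
  bound : Set (E n) → Set (E n) → ℝ
  one_le_bound : ∀ A B, 1 ≤ bound A B
  param : ℝ → Set (E n) → Set (E n) → ℝ
  param_spec : ∀ t A B, (reparamSet center (bound A B) t A B).Nonempty →
    param t A B ∈ reparamSet center (bound A B) t A B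
  radius : ℝ → Set (E n) → Set (E n) → ℝ
  radius_spec : ∀ t A B, (radiusSet t A B).Nonempty → radius t A B ∈ radiusSet t A B
  threshold : Set (E n) → Set (E n) → ℝ
  threshold_pos : ∀ A B, 0 < threshold A B

open scoped Classical in
theorem nonempty_averageChoices (n : ℕ) : Nonempty (AverageChoices n) := by
  let c : Set (E n) → E n := fun A => if h : ∃ q, IsCenter A q then h.choose else 0
  refine ⟨⟨c, ?_, fun _ _ => 1, fun _ _ => le_rfl,
    fun t A B => if h : (reparamSet c 1 t A B).Nonempty then h.choose else 0, ?_,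
    fun t A B => if h : (radiusSet t A B).Nonempty then h.choose else 0, ?_,
    fun _ _ => 1, fun _ _ => one_pos⟩⟩
  · intro A h
    simp only [c, dif_pos h]
    exact h.choose_spec
  · intro t A B h
    simp only [dif_pos h]
    exact h.choose_spec
  · intro t A B h
    simp only [dif_pos h]
    exact h.choose_spec

open scoped Classical in
/-- The measure average of simply different sets `B ⊂ A` (i.e. `A \ B` is treated as one
component). -/
noncomputable def simpleAverage {n : ℕ} (c : AverageChoices n) (t : ℝ)
    (A B : Set (E n)) : Set (E n) :=
  if ZeroMeasureCondition c.center A B ∨ t ∉ Set.Icc (0 : ℝ) 1 then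
    ci (distanceAverage c.center (c.param t A B) A B)
  else ci (offset B (c.radius t A B) ∩ A)

/-- The collection of connected components of `D`. -/
def components {n : ℕ} (D : Set (E n)) : Set (Set (E n)) :=
  {C | ∃ x ∈ D, C = connectedComponentIn D x}

open scoped Classical in
/-- The parts into which `D` is split: its connected components if these are finitely many;
otherwise the components of measure at least `ε`, and the union of all the others as one part. -/
noncomputable def parts {n : ℕ} (ε : ℝ) (D : Set (E n)) : Set (Set (E n)) :=
  if (components D).Finite then components D
  else {C ∈ components D | ENNReal.ofReal ε ≤ volume C} ∪
    {⋃₀ {C ∈ components D | volume C < ENNReal.ofReal ε}}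

open scoped Classical in
/-- The measure average of nested sets `B ⊆ A`. -/
noncomputable def nestedAverage {n : ℕ} (c : AverageChoices n) (t : ℝ)
    (A B : Set (E n)) : Set (E n) :=
  if A = B then A
  else if 0 ≤ t then ⋃ C ∈ parts (c.threshold A B) (A \ B), simpleAverage c t (B ∪ C) B
  else ci (⋂ C ∈ parts (c.threshold A B) (A \ B), simpleAverage c t (B ∪ C) B)

/-- The measure average for weights `t > 1`. -/
noncomputable def extrapolation {n : ℕ} (c : AverageChoices n) (t : ℝ)
    (A B : Set (E n)) : Set (E n) :=
  ci (nestedAverage c t A (ci (A ∩ B)) \ (A ∩ B)) ∪ nestedAverage c (1 - t) B (ci (A ∩ B))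

open scoped Classical in
/-- The measure average `t A ⊕ (1 - t) B`. -/
noncomputable def measureAverage {n : ℕ} (c : AverageChoices n) (t : ℝ)
    (A B : Set (E n)) : Set (E n) :=
  if t < 0 then extrapolation c (1 - t) B A
  else if t ≤ 1 then
    nestedAverage c t A (ci (A ∩ B)) ∪ nestedAverage c (1 - t) B (ci (A ∩ B))
  else extrapolation c t A B

/-- The doubling step combined with the first averaging step. -/
noncomputable def doubled {n : ℕ} (c : AverageChoices n) (F : ℤ → Set (E n)) : ℤ → Set (E n) :=
  fun i => if Even i then F (i / 2) else measureAverage c (1 / 2) (F (i / 2)) (F (i / 2 + 1))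

/-- One further averaging step. -/
noncomputable def averaged {n : ℕ} (c : AverageChoices n) (F : ℤ → Set (E n)) : ℤ → Set (E n) :=
  fun i => measureAverage c (1 / 2) (F i) (F (i + 1))

/-- One refinement step of the set-valued spline subdivision scheme of degree `m`. -/
noncomputable def refineSets {n : ℕ} (c : AverageChoices n) (m : ℕ) (F : ℤ → Set (E n)) :
    ℤ → Set (E n) :=
  fun i => (averaged c)^[m - 1] (doubled c F) (i - ⌊((m : ℚ) - 1) / 2⌋)

/-- The piecewise interpolant at level `k` through the sets obtained from `F` by `k` refinements:
with `i = ⌊2ᵏ x⌋` and `λ = (i + 1) - 2ᵏ x` it is `λ Fᵢᵏ ⊕ (1 - λ) Fᵢ₊₁ᵏ`. -/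
noncomputable def setInterpolant {n : ℕ} (c : AverageChoices n) (m : ℕ) (F : ℤ → Set (E n))
    (k : ℕ) (x : ℝ) : Set (E n) :=
  measureAverage c ((⌊x * 2 ^ k⌋ : ℝ) + 1 - x * 2 ^ k)
    ((refineSets c m)^[k] F ⌊x * 2 ^ k⌋) ((refineSets c m)^[k] F (⌊x * 2 ^ k⌋ + 1))

/-- `Finf` is the limit of the set-valued scheme started at `F`, in the metric `dMu` (hence it is
determined up to null sets at each point). -/
def IsSetLimit {n : ℕ} (c : AverageChoices n) (m : ℕ) (F : ℤ → Set (E n))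
    (Finf : ℝ → Set (E n)) : Prop :=
  ∀ x, LebesgueFinite (Finf x) ∧
    Filter.Tendsto (fun k => dMu (setInterpolant c m F k x) (Finf x)) Filter.atTop (nhds 0)

/-- The mask of the real-valued spline scheme of degree `m`. -/
noncomputable def mask (m : ℕ) (l : ℤ) : ℝ :=
  if 0 ≤ l ∧ l ≤ (m : ℤ) + 1 then ((m + 1).choose l.toNat : ℝ) / 2 ^ m else 0

/-- One refinement step of the real-valued scheme; the sum has finitely many nonzero terms. -/
noncomputable def refineReal (m : ℕ) (f : ℤ → ℝ) : ℤ → ℝ :=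
  fun i => ∑ᶠ j : ℤ, mask m (⌈((m : ℚ) + 1) / 2⌉ + i - 2 * j) * f j

/-- The piecewise linear interpolant at level `k`. -/
noncomputable def realInterpolant (m : ℕ) (f : ℤ → ℝ) (k : ℕ) (x : ℝ) : ℝ :=
  ((⌊x * 2 ^ k⌋ : ℝ) + 1 - x * 2 ^ k) * (refineReal m)^[k] f ⌊x * 2 ^ k⌋ +
    (1 - ((⌊x * 2 ^ k⌋ : ℝ) + 1 - x * 2 ^ k)) * (refineReal m)^[k] f (⌊x * 2 ^ k⌋ + 1)

/-- `finf` is the limit function of the real-valued scheme started at `f`. -/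
def IsRealLimit (m : ℕ) (f : ℤ → ℝ) (finf : ℝ → ℝ) : Prop :=
  ∀ x, Filter.Tendsto (fun k => realInterpolant m f k x) Filter.atTop (nhds (finf x))

end SetSpline

namespace SetSpline

open MeasureTheory Metric Set Filter Topology

/-! For t in [0,1] the measure average M of A and B stays in the class of regular Jordan sets,
satisfies μ(M) = tμ(A) + (1-t)μ(B), and satisfies d(A,M) = (1-t)d(A,B) (`measureAverage_spec`). The
schemes use nothing else. The first two facts make measure commute with every refinement and with
the interpolation, because the spline mask factors into one doubling step and repeated midpoint
averaging (`refineReal_eq_averagedReal_iterate`). The third halves the local step size at each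
level, so the interpolants at each x form a geometric Cauchy sequence in a complete metric. Measure
is 1-Lipschitz for that metric, so the real limit exists and equals the measure of the set limit.

The work lies in showing that the free choices have candidates of exactly the right measure
(`isAverage_simpleAverage`). The intermediate value theorem gives them once the level sets of the
interpolated distances are null. For unequal weights this holds by porosity; for equal weights it is
the zero-measure condition; when that condition fails, offsets replace distance averages. Averages
over the parts of A \ B are then a.e. disjoint outside B, and their measures add
(`isAverage_nestedAverage`). -/

/-! ### Null level sets of distance functions -/

theorem volume_eq_zero_of_porous {n : ℕ} {Z : Set (E n)} {κ : ℝ} (hκ : 0 < κ)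
    (h : ∀ p ∈ Z, ∃ δ₀ > 0, ∀ δ, 0 < δ → δ < δ₀ →
      ∃ y, dist p y ≤ δ ∧ Disjoint (closedBall y (κ * δ)) Z) :
    volume Z = 0 := by
  -- Lebesgue density with off-centre balls: the ball of radius κδ about y, dilated by κ⁻¹, contains
  -- p, so its density ratio tends to 1 for almost every p in Z. The holes make that ratio 0.
  have key := IsUnifLocDoublingMeasure.ae_tendsto_measure_inter_div (volume : Measure (E n)) Z κ⁻¹
  rw [ae_iff] at key
  -- Z is not known to be measurable; `Measure.le_restrict_apply` bounds the measure of Z ∩ Z by the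
  -- restricted measure without that.
  refine measure_mono_null (t := Z ∩ Z) (by simp) ?_
  refine le_antisymm ?_ zero_le
  refine (Measure.le_restrict_apply Z Z).trans ?_
  refine (measure_mono fun p hp => ?_).trans key.le
  intro hlim
  obtain ⟨δ₀, hδ₀, h⟩ := h p hp
  choose! y hy hd using h
  have hev : ∀ᶠ δ : ℝ in 𝓝[>] 0, 0 < δ ∧ δ < δ₀ :=
    Ioo_mem_nhdsGT hδ₀
  have h1 := hlim (l := 𝓝[>] (0 : ℝ)) y (fun δ => κ * δ) (by
      rw [tendsto_nhdsWithin_iff]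
      constructor
      · have : Tendsto (fun δ : ℝ => κ * δ) (𝓝 0) (𝓝 (κ * 0)) := (continuous_const_mul κ).tendsto 0
        rw [mul_zero] at this
        exact this.mono_left nhdsWithin_le_nhds
      · filter_upwards [hev] with δ hδ using mul_pos hκ hδ.1) (by
      filter_upwards [hev] with δ hδ
      rw [inv_mul_cancel_left₀ hκ.ne']
      exact hy δ hδ.1 hδ.2)
  have h0 : Tendsto (fun δ => volume (Z ∩ closedBall (y δ) (κ * δ)) /
      volume (closedBall (y δ) (κ * δ))) (𝓝[>] (0 : ℝ)) (𝓝 0) := by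
    refine tendsto_const_nhds.congr' ?_
    filter_upwards [hev] with δ hδ
    rw [(hd δ hδ.1 hδ.2).symm.inter_eq]
    simp
  exact zero_ne_one (tendsto_nhds_unique h0 h1)

/-- Level sets of `d(·, X) - c d(·, Y)` with `c < 1` are null away from `X`. -/
theorem volume_infDist_sub_mul_infDist_eq {n : ℕ} {X Y : Set (E n)} (hX : IsClosed X)
    (hX0 : X.Nonempty) {c : ℝ} (hc0 : 0 ≤ c) (hc : c < 1) (v : ℝ) :
    volume {p | p ∉ X ∧ infDist p X - c * infDist p Y = v} = 0 := by
  refine volume_eq_zero_of_porous (κ := (1 - c) / 4) (by linarith) ?_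
  rintro p ⟨hpX, hp⟩
  obtain ⟨x, hxX, hx⟩ := hX.exists_infDist_eq_dist hX0 p
  have hpos : 0 < infDist p X := (hX.notMem_iff_infDist_pos hX0).1 hpX
  refine ⟨infDist p X, hpos, fun δ hδ hδ' => ?_⟩
  set s := δ / infDist p X with hs
  have hs0 : 0 ≤ s := by positivity
  have hs1 : s ≤ 1 := (div_le_one hpos).2 hδ'.le
  have hsm : s * infDist p X = δ := div_mul_cancel₀ _ hpos.ne'
  -- A move by δ towards the nearest point x lowers d(·, X) by δ and c d(·, Y) by at most cδ. The
  -- gap (1-c)δ survives on a ball of radius (1-c)δ/4.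
  refine ⟨AffineMap.lineMap p x s, ?_, ?_⟩
  · rw [dist_left_lineMap, Real.norm_of_nonneg hs0, ← hx, hsm]
  · rw [Set.disjoint_left]
    rintro z hz ⟨-, hzv⟩
    rw [mem_closedBall] at hz
    have hdpy : dist (AffineMap.lineMap p x s : E n) p = δ := by
      rw [dist_lineMap_left, Real.norm_of_nonneg hs0, ← hx, hsm]
    have hdyx : dist (AffineMap.lineMap p x s : E n) x = infDist p X - δ := by
      rw [dist_lineMap_right, Real.norm_of_nonneg (by linarith), ← hx, sub_mul, hsm, one_mul]
    have h1 : infDist z X ≤ infDist p X - δ + (1 - c) / 4 * δ := by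
      have := infDist_le_dist_of_mem (x := z) hxX
      have := dist_triangle z (AffineMap.lineMap p x s : E n) x
      linarith
    have h2 : infDist p Y ≤ infDist z Y + (δ + (1 - c) / 4 * δ) := by
      have := infDist_le_infDist_add_dist (s := Y) (x := p) (y := z)
      have := dist_triangle z (AffineMap.lineMap p x s : E n) p
      have := dist_comm p z
      linarith
    nlinarith [mul_le_mul_of_nonneg_left h2 hc0, mul_pos hδ (sub_pos.2 hc),
      mul_pos (mul_pos hδ (sub_pos.2 hc)) (sub_pos.2 hc)]

theorem volume_infDist_eq {n : ℕ} {X : Set (E n)} (hX0 : X.Nonempty) {r : ℝ} (hr : 0 < r) :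
    volume {p | infDist p X = r} = 0 := by
  refine measure_mono_null ?_ (volume_infDist_sub_mul_infDist_eq (Y := ∅) isClosed_closure
    hX0.closure le_rfl one_pos r)
  intro p (hp : infDist p X = r)
  refine ⟨fun h => ?_, by simpa [infDist_closure] using hp⟩
  rw [mem_closure_iff_infDist_zero hX0] at h
  linarith

/-- Dividing by the larger weight gives a ratio below one, and the set carrying that weight is
itself null. Equal weights must be excluded: if X and Y share points, the two distances can agree on
an open set. -/
theorem volume_mul_infDist_eq_mul_infDist {n : ℕ} {X Y : Set (E n)} (hX : IsClosed X)
    (hX0 : X.Nonempty) (hXv : volume X = 0) (hY : IsClosed Y) (hY0 : Y.Nonempty)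
    (hYv : volume Y = 0) {a b : ℝ} (ha : 0 ≤ a) (hb : 0 ≤ b) (hab : a ≠ b) :
    volume {p | a * infDist p X = b * infDist p Y} = 0 := by
  have aux : ∀ {X Y : Set (E n)}, IsClosed X → X.Nonempty → volume X = 0 → ∀ {a b : ℝ},
      0 ≤ a → 0 ≤ b → b < a → volume {p | a * infDist p X = b * infDist p Y} = 0 := by
    intro X Y hX hX0 hXv a b ha hb hab
    have ha' : 0 < a := hb.trans_lt hab
    refine measure_mono_null ?_ (measure_union_null hXv
      (volume_infDist_sub_mul_infDist_eq (Y := Y) hX hX0 (div_nonneg hb ha)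
      ((div_lt_one ha').2 hab) 0))
    intro p (hp : _ = _)
    by_cases hpX : p ∈ X
    · exact Or.inl hpX
    · refine Or.inr ⟨hpX, ?_⟩
      rw [div_mul_eq_mul_div, ← hp, mul_div_cancel_left₀ _ ha'.ne', sub_self]
  rcases lt_or_gt_of_ne hab with h | h
  · simp_rw [eq_comm (a := a * _)]
    exact aux hY hY0 hYv hb ha h
  · exact aux hX hX0 hXv ha hb h

/-- Points at the same distance from `q` and from a closed set not containing `q` form a null
set: they lie on the boundary of a Voronoi cell. -/
theorem volume_infDist_eq_dist {n : ℕ} {X : Set (E n)} (hX : IsClosed X) (hX0 : X.Nonempty)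
    {q : E n} (hq : q ∉ X) : volume {p | infDist p X = dist p q} = 0 := by
  have hcell : {p : E n | dist p q ≤ infDist p X} =
      ⋂ x ∈ X, {p : E n | inner ℝ p (x - q) ≤ (‖x‖ ^ 2 - ‖q‖ ^ 2) / 2} := by
    ext p
    simp only [mem_ofPred_eq, le_infDist hX0, mem_iInter]
    refine forall₂_congr fun x _ => ?_
    rw [dist_eq_norm, dist_eq_norm, ← sq_le_sq₀ (norm_nonneg _) (norm_nonneg _),
      norm_sub_sq_real, norm_sub_sq_real, inner_sub_right]
    constructor <;> intro h <;> linarith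
  have hconv : Convex ℝ {p : E n | dist p q ≤ infDist p X} := by
    rw [hcell]
    refine convex_iInter₂ fun x _ => ?_
    refine convex_halfSpace_le ?_ _
    exact ⟨fun a b => inner_add_left _ _ _, fun c a => by simp [inner_smul_left]⟩
  refine measure_mono_null ?_ (hconv.addHaar_frontier volume)
  intro p (hp : infDist p X = dist p q)
  refine ⟨subset_closure hp.ge, fun hint => ?_⟩
  obtain ⟨x, hxX, hx⟩ := hX.exists_infDist_eq_dist hX0 p
  have hxq : x - q ≠ 0 := fun h => hq (sub_eq_zero.1 h ▸ hxX)
  -- p lies on the hyperplane bounding the half-space of its nearest point x, so moving in the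
  -- direction x - q leaves the cell at once.
  have hcont : Tendsto (fun s : ℝ => p + s • (x - q)) (𝓝[>] 0) (𝓝 p) := by
    have : Continuous fun s : ℝ => p + s • (x - q) := by fun_prop
    have := this.tendsto 0
    rw [zero_smul, add_zero] at this
    exact this.mono_left nhdsWithin_le_nhds
  have hev := hcont.eventually (isOpen_interior.mem_nhds hint)
  obtain ⟨s, hs, hs0⟩ := (hev.and self_mem_nhdsWithin).exists
  have h1 := interior_subset hs
  rw [hcell] at h1
  have h1 := mem_iInter₂.1 h1 x hxX
  simp only [mem_ofPred_eq, inner_add_left, inner_smul_left] at h1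
  have h2 : dist p q = dist p x := hp.symm.trans hx
  have h3 : inner ℝ p (x - q) = (‖x‖ ^ 2 - ‖q‖ ^ 2) / 2 := by
    have : dist p q ^ 2 = dist p x ^ 2 := by rw [h2]
    rw [dist_eq_norm, dist_eq_norm, norm_sub_sq_real, norm_sub_sq_real] at this
    rw [inner_sub_right]; linarith
  rw [h3, real_inner_self_eq_norm_sq] at h1
  have : 0 < s * ‖x - q‖ ^ 2 := mul_pos hs0 (by positivity)
  simp at h1
  linarith

/-! ### Signed distance -/

section SignedDistance

variable {n : ℕ}

/-- A segment joining a point of `S` to a point outside `S` meets the frontier of `S`. -/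
theorem exists_mem_frontier_dist_add_dist {S : Set (E n)} {p y : E n} (h : p ∈ S ↔ y ∉ S) :
    ∃ z ∈ frontier S, dist p z + dist z y = dist p y := by
  have hpre : IsPreconnected (segment ℝ p y) := (convex_segment p y).isPreconnected
  have hp : p ∈ segment ℝ p y := left_mem_segment ℝ p y
  have hy : y ∈ segment ℝ p y := right_mem_segment ℝ p y
  have hne : (segment ℝ p y ∩ frontier S).Nonempty := by
    by_contra hemp
    rw [not_nonempty_iff_eq_empty] at hemp
    have hsub : segment ℝ p y ⊆ interior S ∪ interior Sᶜ := by
      intro z hz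
      by_contra hz'
      rw [← compl_frontier_eq_union_interior] at hz'
      exact (eq_empty_iff_forall_notMem.1 hemp) z ⟨hz, not_not.1 hz'⟩
    have hdis : Disjoint (interior S) (interior Sᶜ) :=
      disjoint_compl_right.mono interior_subset interior_subset
    rcases hpre.subset_or_subset isOpen_interior isOpen_interior hdis hsub with h' | h'
    · exact h.1 (interior_subset (h' hp)) (interior_subset (h' hy))
    · exact (interior_subset (h' hy)) (by_contra fun hy' =>
        (interior_subset (h' hp)) (h.2 hy'))
  obtain ⟨z, hz, hzf⟩ := hne
  exact ⟨z, hzf, dist_add_dist_of_mem_segment hz⟩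

theorem infDist_frontier_le_dist {S : Set (E n)} {p y : E n} (h : p ∈ S ↔ y ∉ S) :
    infDist p (frontier S) ≤ dist p y := by
  obtain ⟨z, hz, hd⟩ := exists_mem_frontier_dist_add_dist h
  have := infDist_le_dist_of_mem (x := p) hz
  have := dist_nonneg (x := z) (y := y)
  linarith

theorem abs_signedDist (p : E n) (A : Set (E n)) : |signedDist p A| = infDist p (frontier A) := by
  unfold signedDist
  split_ifs
  · exact abs_of_nonneg infDist_nonneg
  · rw [abs_neg, abs_of_nonneg infDist_nonneg]

theorem signedDist_nonneg {p : E n} {A : Set (E n)} (hp : p ∈ A) : 0 ≤ signedDist p A := by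
  rw [signedDist, if_pos hp]; exact infDist_nonneg

theorem signedDist_nonpos {p : E n} {A : Set (E n)} (hp : p ∉ A) : signedDist p A ≤ 0 := by
  rw [signedDist, if_neg hp]; exact neg_nonpos.2 infDist_nonneg

/-- On the same side this is the Lipschitz bound for the distance to the frontier. On opposite sides
the segment crosses the frontier, so the two distances add up to at most `dist p q`. -/
theorem abs_signedDist_sub_le (p q : E n) (A : Set (E n)) :
    |signedDist p A - signedDist q A| ≤ dist p q := by
  have h1 := infDist_le_infDist_add_dist (s := frontier A) (x := p) (y := q)
  have h2 := infDist_le_infDist_add_dist (s := frontier A) (x := q) (y := p)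
  rw [dist_comm q p] at h2
  have cross : (p ∈ A ↔ q ∉ A) →
      infDist p (frontier A) + infDist q (frontier A) ≤ dist p q := by
    intro h
    obtain ⟨z, hz, hd⟩ := exists_mem_frontier_dist_add_dist h
    have h3 := infDist_le_dist_of_mem (x := p) hz
    have h4 := infDist_le_dist_of_mem (x := q) hz
    rw [dist_comm q z] at h4
    linarith
  have h3 := infDist_nonneg (s := frontier A) (x := p)
  have h4 := infDist_nonneg (s := frontier A) (x := q)
  unfold signedDist
  rw [abs_le]
  split_ifs with hp hq hq
  · constructor <;> linarith
  · have := cross (by tauto); constructor <;> linarith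
  · have := cross (by tauto); constructor <;> linarith
  · constructor <;> linarith

theorem continuous_signedDist (A : Set (E n)) : Continuous fun p => signedDist p A := by
  refine (LipschitzWith.of_dist_le_mul (K := 1) fun p q => ?_).continuous
  rw [NNReal.coe_one, one_mul, Real.dist_eq]
  exact abs_signedDist_sub_le p q A

/-- Inside B, a frontier point of A is a limit of points outside B, and reaching those means
crossing the frontier of B; the case outside A is dual. Nonempty frontiers are essential because
`infDist` to the empty set is 0. -/
theorem signedDist_mono {A B : Set (E n)} (h : B ⊆ A) (hA : (frontier A).Nonempty)
    (hB : (frontier B).Nonempty) (p : E n) : signedDist p B ≤ signedDist p A := by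
  have hcl : ∀ (T : Set (E n)) (r : ℝ), (∀ y ∈ T, r ≤ dist p y) → ∀ y ∈ closure T, r ≤ dist p y :=
    fun T r hr => closure_minimal hr (isClosed_le continuous_const (continuous_const.dist
      continuous_id))
  by_cases hpA : p ∈ A
  · by_cases hpB : p ∈ B
    · rw [signedDist, signedDist, if_pos hpA, if_pos hpB, le_infDist hA]
      intro z hz
      refine hcl Aᶜ _ (fun y hy => infDist_frontier_le_dist ?_) z ?_
      · have : y ∉ B := fun hy' => hy (h hy')
        tauto
      · rw [frontier_eq_closure_inter_closure] at hz; exact hz.2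
    · exact (signedDist_nonpos hpB).trans (signedDist_nonneg hpA)
  · have hpB : p ∉ B := fun hp => hpA (h hp)
    rw [signedDist, signedDist, if_neg hpA, if_neg hpB, neg_le_neg_iff, le_infDist hB]
    intro z hz
    refine hcl A _ (fun y hy => infDist_frontier_le_dist ?_) z (closure_mono h hz.1)
    tauto

/-- Dimension 0 is a genuine exception: there the whole space is bounded and has empty frontier. -/
theorem frontier_nonempty (hn : 1 ≤ n) {A : Set (E n)} (hA : Bornology.IsBounded A)
    (hA0 : A.Nonempty) : (frontier A).Nonempty := by
  have : Nonempty (Fin n) := ⟨⟨0, hn⟩⟩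
  rw [nonempty_frontier_iff]
  refine ⟨hA0, fun h => ?_⟩
  rw [h] at hA
  exact NormedSpace.unbounded_univ ℝ (E n) hA

theorem mem_closure_of_signedDist_nonneg {A : Set (E n)} (hA : (frontier A).Nonempty) {p : E n}
    (hp : 0 ≤ signedDist p A) : p ∈ closure A := by
  by_cases h : p ∈ A
  · exact subset_closure h
  · rw [signedDist, if_neg h] at hp
    have h0 : infDist p (frontier A) = 0 := le_antisymm (by linarith) infDist_nonneg
    rw [← isClosed_frontier.mem_iff_infDist_zero hA] at h0
    exact h0.1

theorem setOf_signedDist_nonneg {A : Set (E n)} (hA : (frontier A).Nonempty) :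
    {p | 0 ≤ signedDist p A} = closure A := by
  refine Subset.antisymm (fun p hp => mem_closure_of_signedDist_nonneg hA hp) ?_
  exact closure_minimal (fun p hp => signedDist_nonneg hp)
    (isClosed_le continuous_const (continuous_signedDist A))

/-- A need not be closed, so the maximum is taken over the compact closure; by continuity it is the
supremum over A. -/
theorem exists_isCenter {A : Set (E n)} (hA : Bornology.IsBounded A) (hA0 : A.Nonempty) :
    ∃ q, IsCenter A q := by
  obtain ⟨q, hq, hmax⟩ := hA.isCompact_closure.exists_isMaxOn hA0.closure
    (continuous_signedDist A).continuousOn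
  refine ⟨q, ?_, ?_⟩
  · rintro _ ⟨a, ha, rfl⟩
    exact hmax (subset_closure ha)
  · intro v hv
    refine closure_minimal (t := {p | signedDist p A ≤ v}) (fun a ha => hv ⟨a, ha, rfl⟩)
      (isClosed_le (continuous_signedDist A) continuous_const) hq

theorem IsCenter.signedDist_nonneg {A : Set (E n)} {q : E n} (h : IsCenter A q)
    (hA0 : A.Nonempty) : 0 ≤ signedDist q A := by
  obtain ⟨a, ha⟩ := hA0
  exact (SetSpline.signedDist_nonneg ha).trans (h.1 ⟨a, ha, rfl⟩)

end SignedDistance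

/-! ### Superlevel sets of interpolated level functions -/

variable {n : ℕ}

/-- Two level functions `b ≤ a` whose absolute values are the distances to the bounded closed null
sets `Y` and `X`. -/
structure LevelPair (a b : E n → ℝ) (X Y : Set (E n)) (R : ℝ) : Prop where
  continuous_upper : Continuous a
  continuous_lower : Continuous b
  abs_upper : ∀ p, |a p| = infDist p X
  abs_lower : ∀ p, |b p| = infDist p Y
  lower_le : ∀ p, b p ≤ a p
  isClosed_upper : IsClosed X
  isClosed_lower : IsClosed Y
  nonempty_upper : X.Nonempty
  nonempty_lower : Y.Nonempty
  null_upper : volume X = 0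
  null_lower : volume Y = 0
  subset_upper : X ⊆ closedBall 0 R
  subset_lower : Y ⊆ closedBall 0 R
  subset_nonneg : {p | 0 ≤ a p} ⊆ closedBall 0 R

/-- The superlevel sets of the interpolated level functions. -/
def levelSet (a b : E n → ℝ) (g : ℝ) : Set (E n) := {p | 0 ≤ g * a p + (1 - g) * b p}

namespace LevelPair

variable {a b : E n → ℝ} {X Y : Set (E n)} {R : ℝ}

theorem monotone (h : LevelPair a b X Y R) : Monotone (levelSet a b) := by
  intro g g' hg p hp
  simp only [levelSet, mem_ofPred_eq] at hp ⊢
  nlinarith [mul_le_mul_of_nonneg_left (h.lower_le p) (sub_nonneg.2 hg)]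

/-- Where a < 0, both |a| and |b| are distances to subsets of the ball of radius R, so a - b ≤ 2R
and hence |b| ≤ 2R|g|. The bound covers g outside [0,1], where a minimizer may lie. -/
theorem levelSet_subset (h : LevelPair a b X Y R) (g : ℝ) :
    levelSet a b g ⊆ closedBall 0 (R + |g| * (4 * R)) := by
  intro p hp
  simp only [levelSet, mem_ofPred_eq] at hp
  obtain ⟨x, hx, hdx⟩ := h.isClosed_upper.exists_infDist_eq_dist h.nonempty_upper p
  obtain ⟨y, hy⟩ := h.nonempty_lower
  have hdy := infDist_le_dist_of_mem (x := p) hy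
  have hxR := h.subset_upper hx
  have hyR := h.subset_lower hy
  rw [mem_closedBall_zero_iff] at hxR hyR ⊢
  have hR : 0 ≤ R := (norm_nonneg _).trans hxR
  rcases le_or_gt 0 (a p) with ha | ha
  · have := h.subset_nonneg ha
    rw [mem_closedBall_zero_iff] at this
    have : 0 ≤ |g| * (4 * R) := by positivity
    linarith
  · have h1 := h.abs_upper p
    rw [abs_of_neg ha, hdx, dist_eq_norm] at h1
    have h2 := h.abs_lower p
    have h3 := h.lower_le p
    rw [abs_of_neg (h3.trans_lt ha)] at h2
    rw [dist_eq_norm] at hdy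
    have h4 := norm_sub_norm_le p x
    have h5 := norm_sub_le p y
    have h6 : a p - b p ≤ 2 * R := by linarith
    have h7 : g * (a p - b p) ≤ |g| * (2 * R) :=
      (mul_le_mul_of_nonneg_right (le_abs_self g) (by linarith)).trans
        (mul_le_mul_of_nonneg_left h6 (abs_nonneg g))
    have h8 : 0 ≤ |g| * R := by positivity
    nlinarith

theorem measure_levelSet_ne_top (h : LevelPair a b X Y R) (g : ℝ) :
    volume (levelSet a b g) ≠ ⊤ :=
  ((measure_mono (h.levelSet_subset g)).trans_lt measure_closedBall_lt_top).ne

theorem isClosed_levelSet (h : LevelPair a b X Y R) (g : ℝ) : IsClosed (levelSet a b g) := by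
  have h1 := h.continuous_upper
  have h2 := h.continuous_lower
  exact isClosed_le continuous_const (by fun_prop)

theorem frontier_levelSet_subset (h : LevelPair a b X Y R) (g : ℝ) :
    frontier (levelSet a b g) ⊆ {p | g * a p + (1 - g) * b p = 0} := by
  have h1 := h.continuous_upper
  have h2 := h.continuous_lower
  intro p hp
  exact (frontier_le_subset_eq continuous_const (by fun_prop) hp).symm

/-- On the zero level |g| d(·, X) = |1-g| d(·, Y), and the weights agree only at g = 1/2. This is
why the zero-measure condition concerns that value alone. -/
theorem measure_zero_level (h : LevelPair a b X Y R) {g : ℝ} (hg : g ≠ 1 / 2) :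
    volume {p | g * a p + (1 - g) * b p = 0} = 0 := by
  have hne : |g| ≠ |1 - g| := by
    intro h'
    rcases abs_eq_abs.1 h' with h' | h'
    · exact hg (by linarith)
    · linarith
  refine measure_mono_null ?_ (volume_mul_infDist_eq_mul_infDist h.isClosed_upper h.nonempty_upper
    h.null_upper h.isClosed_lower h.nonempty_lower h.null_lower (abs_nonneg g)
    (abs_nonneg (1 - g)) hne)
  intro p (hp : _ = _)
  show _ = _
  rw [← h.abs_upper, ← h.abs_lower, ← abs_mul, ← abs_mul, abs_eq_abs]
  right; linarith

/-- Off the null zero level at g₀ the sign of the level function is locally constant in g, so the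
indicators converge a.e.; the level set at g = 1 dominates. -/
theorem continuousOn_measure (h : LevelPair a b X Y R)
    (hz : volume {p | 1 / 2 * a p + (1 - 1 / 2) * b p = 0} = 0) :
    ContinuousOn (fun g => volume.real (levelSet a b g)) (Icc 0 1) := by
  intro g₀ _
  have hnull : volume {p | g₀ * a p + (1 - g₀) * b p = 0} = 0 := by
    by_cases hg : g₀ = 1 / 2
    · rw [hg]; exact hz
    · exact h.measure_zero_level hg
  refine (ENNReal.tendsto_toReal (h.measure_levelSet_ne_top g₀)).comp ?_
  refine tendsto_measure_of_ae_tendsto_indicator _ (h.isClosed_levelSet _).measurableSet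
    (fun i => (h.isClosed_levelSet _).measurableSet) (h.isClosed_levelSet 1).measurableSet
    (h.measure_levelSet_ne_top 1) ?_ ?_
  · filter_upwards [self_mem_nhdsWithin] with g hg using h.monotone hg.2
  · have : ∀ᵐ p : E n, ¬ (g₀ * a p + (1 - g₀) * b p = 0) := by
      rw [ae_iff]; simpa using hnull
    filter_upwards [this] with p hp
    have hc : Continuous fun g : ℝ => g * a p + (1 - g) * b p := by fun_prop
    have hc : Tendsto (fun g : ℝ => g * a p + (1 - g) * b p) (𝓝[Icc 0 1] g₀)
      (𝓝 (g₀ * a p + (1 - g₀) * b p)) := (hc.tendsto g₀).mono_left nhdsWithin_le_nhds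
    rcases lt_or_gt_of_ne hp with hp | hp
    · filter_upwards [hc.eventually (gt_mem_nhds hp)] with g hg
      exact iff_of_false (not_le.2 hg) (not_le.2 hp)
    · filter_upwards [hc.eventually (lt_mem_nhds hp)] with g hg
      exact iff_of_true hg.le hp.le

theorem exists_measure_eq (h : LevelPair a b X Y R)
    (hz : volume {p | 1 / 2 * a p + (1 - 1 / 2) * b p = 0} = 0) {t : ℝ} (ht : t ∈ Icc (0 : ℝ) 1) :
    ∃ g ∈ Icc (0 : ℝ) 1, volume.real (levelSet a b g) =
      t * volume.real (levelSet a b 1) + (1 - t) * volume.real (levelSet a b 0) := by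
  have h01 : volume.real (levelSet a b 0) ≤ volume.real (levelSet a b 1) :=
    measureReal_mono (h.monotone zero_le_one) (h.measure_levelSet_ne_top 1)
  have := intermediate_value_Icc zero_le_one (h.continuousOn_measure hz)
  refine this ⟨?_, ?_⟩ <;> nlinarith [ht.1, ht.2]

/-- For g < 0 monotonicity gives the reverse inclusion, and the measure hypothesis then forces a.e.
equality. This, with its counterpart above 1, handles minimizers outside [0,1]. -/
theorem levelSet_zero_ae_le (h : LevelPair a b X Y R) {g : ℝ}
    (hg : volume.real (levelSet a b 0) ≤ volume.real (levelSet a b g)) :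
    levelSet a b 0 ≤ᵐ[volume] levelSet a b g := by
  rcases le_total 0 g with h0 | h0
  · exact (h.monotone h0).eventuallyLE
  · refine (ae_eq_of_subset_of_measure_ge (h.monotone h0) ?_
      (h.isClosed_levelSet g).measurableSet.nullMeasurableSet
      (h.measure_levelSet_ne_top 0)).symm.le
    exact (ENNReal.toReal_le_toReal (h.measure_levelSet_ne_top 0)
      (h.measure_levelSet_ne_top g)).1 hg

theorem levelSet_ae_le_one (h : LevelPair a b X Y R) {g : ℝ}
    (hg : volume.real (levelSet a b g) ≤ volume.real (levelSet a b 1)) :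
    levelSet a b g ≤ᵐ[volume] levelSet a b 1 := by
  rcases le_total g 1 with h0 | h0
  · exact (h.monotone h0).eventuallyLE
  · refine (ae_eq_of_subset_of_measure_ge (h.monotone h0) ?_
      (h.isClosed_levelSet 1).measurableSet.nullMeasurableSet
      (h.measure_levelSet_ne_top g)).symm.le
    exact (ENNReal.toReal_le_toReal (h.measure_levelSet_ne_top g)
      (h.measure_levelSet_ne_top 1)).1 hg

end LevelPair

/-! ### Regular Jordan sets -/

theorem ci_subset_closure (A : Set (E n)) : ci A ⊆ closure A := closure_mono interior_subset

theorem interior_subset_ci (A : Set (E n)) : interior A ⊆ ci A := subset_closure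

theorem ci_ci (A : Set (E n)) : ci (ci A) = ci A := by
  refine Subset.antisymm ?_ ?_
  · exact closure_minimal interior_subset isClosed_closure
  · exact closure_mono (interior_maximal (interior_subset_ci A) isOpen_interior)

theorem ci_mono {A B : Set (E n)} (h : A ⊆ B) : ci A ⊆ ci B := closure_mono (interior_mono h)

theorem closure_ae_eq_of_null_frontier {A : Set (E n)} (h : volume (frontier A) = 0) :
    closure A =ᵐ[volume] A := by
  rw [closure_eq_self_union_frontier]
  exact union_ae_eq_left_of_ae_eq_empty (ae_eq_empty.2 h)

theorem ci_ae_eq {A : Set (E n)} (h : volume (frontier A) = 0) : ci A =ᵐ[volume] A := by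
  refine EventuallyLE.antisymm ((ci_subset_closure A).eventuallyLE.trans
    (closure_ae_eq_of_null_frontier h).le) ?_
  exact (interior_ae_eq_of_null_frontier h).symm.le.trans (interior_subset_ci A).eventuallyLE

theorem frontier_ci_subset (A : Set (E n)) : frontier (ci A) ⊆ frontier A := by
  rw [IsClosed.frontier_eq (show IsClosed (ci A) from isClosed_closure)]
  exact sdiff_subset_sdiff (ci_subset_closure A)
    (interior_maximal (interior_subset_ci A) isOpen_interior)

theorem regularJordan_ci {A : Set (E n)} (hb : Bornology.IsBounded A)
    (h : volume (frontier A) = 0) : RegularJordan (ci A) :=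
  ⟨hb.closure.subset (ci_subset_closure A), (ci_ci A).symm,
    measure_mono_null (frontier_ci_subset A) h⟩

namespace RegularJordan

variable {A B : Set (E n)}

theorem isClosed (h : RegularJordan A) : IsClosed A := by
  rw [h.2.1]; exact isClosed_closure

theorem union (hA : RegularJordan A) (hB : RegularJordan B) : RegularJordan (A ∪ B) := by
  refine ⟨hA.1.union hB.1, ?_, ?_⟩
  · refine Subset.antisymm (union_subset ?_ ?_) ?_
    · conv_lhs => rw [hA.2.1]
      exact ci_mono subset_union_left
    · conv_lhs => rw [hB.2.1]
      exact ci_mono subset_union_right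
    · exact (ci_subset_closure _).trans (hA.isClosed.union hB.isClosed).closure_eq.subset
  · refine measure_mono_null (frontier_union_subset A B) ?_
    exact measure_union_null (measure_mono_null inter_subset_left hA.2.2)
      (measure_mono_null inter_subset_right hB.2.2)

theorem ci_inter (hA : RegularJordan A) (hB : RegularJordan B) : RegularJordan (ci (A ∩ B)) := by
  refine regularJordan_ci (hA.1.subset inter_subset_left) ?_
  refine measure_mono_null (frontier_inter_subset A B) ?_
  exact measure_union_null (measure_mono_null inter_subset_left hA.2.2)
    (measure_mono_null inter_subset_right hB.2.2)

theorem ci_inter_ae_eq (hA : RegularJordan A) (hB : RegularJordan B) :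
    ci (A ∩ B) =ᵐ[volume] (A ∩ B : Set (E n)) := by
  refine ci_ae_eq (measure_mono_null (frontier_inter_subset A B) ?_)
  exact measure_union_null (measure_mono_null inter_subset_left hA.2.2)
    (measure_mono_null inter_subset_right hB.2.2)

theorem measure_ne_top (h : RegularJordan A) : volume A ≠ ⊤ := h.1.measure_lt_top.ne

theorem empty : RegularJordan (∅ : Set (E n)) := by
  refine ⟨Bornology.isBounded_empty, by simp [ci], by simp⟩

end RegularJordan

/-! ### Averages across a single part -/

/-- `S` lies between `B` and `A` up to null sets and has the interpolated measure. -/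
structure IsAverage (t : ℝ) (A B S : Set (E n)) : Prop where
  regular : RegularJordan S
  lower : B ≤ᵐ[volume] S
  upper : S ≤ᵐ[volume] A
  measure : volume.real S = t * volume.real A + (1 - t) * volume.real B

theorem isAverage_of_null_frontier {t : ℝ} {A B S : Set (E n)} (hb : Bornology.IsBounded S)
    (hf : volume (frontier S) = 0) (hl : B ≤ᵐ[volume] S) (hu : S ≤ᵐ[volume] A)
    (hm : volume.real S = t * volume.real A + (1 - t) * volume.real B) :
    IsAverage t A B (ci S) :=
  ⟨regularJordan_ci hb hf, hl.trans (ci_ae_eq hf).symm.le, (ci_ae_eq hf).le.trans hu,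
    (measureReal_congr (ci_ae_eq hf)).trans hm⟩

/-- For empty B the lower function -‖p - q‖ has Y = {q}; it stays below the signed distance because
that is 1-Lipschitz and nonnegative at the center q. Its nonnegativity set {q} is null, hence a.e.
equal to B. -/
theorem levelPair_of_subset (hn : 1 ≤ n) (c : AverageChoices n) {A B : Set (E n)}
    (hB : RegularJordan B) (hBA : B ⊆ A) (hA : Bornology.IsBounded A) (hA0 : A.Nonempty)
    (hAf : volume (frontier A) = 0) :
    ∃ Y R, LevelPair (fun p => relSignedDist c.center p A B) (fun p => relSignedDist c.center p B A)
      (frontier A) Y R ∧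
      {p | 0 ≤ relSignedDist c.center p B A} =ᵐ[volume] B := by
  have hfA := frontier_nonempty hn hA hA0
  have hrel : ∀ p, relSignedDist c.center p A B = signedDist p A := fun p => by
    rw [relSignedDist, if_neg hA0.ne_empty]
  simp_rw [hrel]
  by_cases hB0 : B = ∅
  · have hrelB : ∀ p, relSignedDist c.center p B A = -‖p - c.center A‖ := fun p => by
      rw [relSignedDist, if_pos hB0]
    simp_rw [hrelB]
    have hq := (c.center_spec A (exists_isCenter hA hA0)).signedDist_nonneg hA0
    obtain ⟨R, hR⟩ := (hA.closure.union (Bornology.isBounded_singleton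
      (x := c.center A))).subset_closedBall 0
    have : Nonempty (Fin n) := ⟨⟨0, hn⟩⟩
    refine ⟨{c.center A}, R, ⟨continuous_signedDist A, by fun_prop, fun p => abs_signedDist p A,
      fun p => ?_, fun p => ?_, isClosed_frontier, isClosed_singleton, hfA, singleton_nonempty _,
      hAf, measure_singleton _, ?_, ?_, ?_⟩, ?_⟩
    · rw [abs_neg, abs_norm, infDist_singleton, dist_eq_norm]
    · have := abs_signedDist_sub_le p (c.center A) A
      rw [dist_eq_norm] at this
      have := (abs_le.1 this).1
      linarith
    · exact frontier_subset_closure.trans (subset_union_left.trans hR)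
    · exact subset_union_right.trans hR
    · rw [setOf_signedDist_nonneg hfA]
      exact subset_union_left.trans hR
    · rw [hB0, ae_eq_empty]
      refine measure_mono_null (t := {c.center A}) (fun p hp => ?_) (measure_singleton _)
      rw [mem_ofPred_eq] at hp
      have := norm_nonneg (p - c.center A)
      exact sub_eq_zero.1 (norm_eq_zero.1 (by linarith))
  · have hrelB : ∀ p, relSignedDist c.center p B A = signedDist p B := fun p => by
      rw [relSignedDist, if_neg hB0]
    simp_rw [hrelB]
    have hfB := frontier_nonempty hn hB.1 (nonempty_iff_ne_empty.2 hB0)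
    obtain ⟨R, hR⟩ := hA.closure.subset_closedBall 0
    refine ⟨frontier B, R, ⟨continuous_signedDist A, continuous_signedDist B,
      fun p => abs_signedDist p A, fun p => abs_signedDist p B, signedDist_mono hBA hfA hfB,
      isClosed_frontier, isClosed_frontier, hfA, hfB, hAf, hB.2.2, ?_, ?_, ?_⟩, ?_⟩
    · exact frontier_subset_closure.trans hR
    · exact (frontier_subset_closure.trans (closure_mono hBA)).trans hR
    · rwa [setOf_signedDist_nonneg hfA]
    · rw [setOf_signedDist_nonneg hfB, hB.isClosed.closure_eq]; exact ae_eq_refl _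

/-- Keeps the offset construction away from empty B. For nonempty A, if q is off the frontier, the
level lies on a Voronoi boundary; if q is on it, the maximal signed distance is 0 and the level lies
in the frontier. -/
theorem zeroMeasureCondition_empty (hn : 1 ≤ n) (c : AverageChoices n) {A : Set (E n)}
    (hA : Bornology.IsBounded A) (hAf : volume (frontier A) = 0) :
    ZeroMeasureCondition c.center A ∅ := by
  have : Nonempty (Fin n) := ⟨⟨0, hn⟩⟩
  unfold ZeroMeasureCondition levelFun relSignedDist
  simp only [if_true]
  by_cases hA0 : A = ∅
  · simp only [hA0, if_true]
    refine measure_mono_null (t := {c.center ∅}) (fun p (hp : _ = _) => ?_) (measure_singleton _)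
    exact sub_eq_zero.1 (norm_eq_zero.1 (by linarith))
  · simp only [hA0, if_false]
    have hA0 := nonempty_iff_ne_empty.2 hA0
    have hfA := frontier_nonempty hn hA hA0
    have hq := c.center_spec A (exists_isCenter hA hA0)
    by_cases hqf : c.center A ∈ frontier A
    · refine measure_mono_null (t := frontier A) (fun p (hp : _ = _) => ?_) hAf
      have h0 : signedDist (c.center A) A = 0 := by
        rw [← abs_eq_zero, abs_signedDist, ← isClosed_frontier.mem_iff_infDist_zero hfA]
        exact hqf
      rw [isClosed_frontier.mem_iff_infDist_zero hfA, ← abs_signedDist, abs_eq_zero]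
      have h1 : 0 ≤ signedDist p A := by linarith [norm_nonneg (p - c.center A)]
      by_cases hpA : p ∈ A
      · exact le_antisymm (h0 ▸ hq.1 ⟨p, hpA, rfl⟩) h1
      · exact le_antisymm (signedDist_nonpos hpA) h1
    · refine measure_mono_null ?_ (volume_infDist_eq_dist isClosed_frontier hfA hqf)
      intro p (hp : _ = _)
      have h1 : signedDist p A = ‖p - c.center A‖ := by linarith
      show _ = _
      rw [← abs_signedDist, h1, abs_norm, dist_eq_norm]

/-- At r = 0 the level {d(·, B) = 0} is B, possibly of positive measure; but B lies in every offset
with r ≥ 0, so continuity within `Ici 0` survives. -/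
theorem continuousOn_measure_offset_inter {A B : Set (E n)} (hBc : IsClosed B) (hB0 : B.Nonempty)
    (hA : NullMeasurableSet A) (hAb : Bornology.IsBounded A) :
    ContinuousOn (fun r => volume.real (offset B r ∩ A)) (Ici 0) := by
  intro r₀ hr₀
  have hfin : volume A ≠ ⊤ := hAb.measure_lt_top.ne
  have hmeas : ∀ r, MeasurableSet (offset B r) := fun r =>
    (isClosed_le (continuous_infDist_pt B) continuous_const).measurableSet
  -- A is only null measurable, whereas the convergence theorem needs measurable sets.
  have heq : ∀ r, volume (offset B r ∩ A) = volume (offset B r ∩ toMeasurable volume A) :=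
    fun r => measure_congr ((ae_eq_refl _).inter hA.toMeasurable_ae_eq.symm)
  simp_rw [ContinuousWithinAt, measureReal_def, heq]
  refine (ENNReal.tendsto_toReal ?_).comp ?_
  · rw [← heq]; exact measure_ne_top_of_subset inter_subset_right hfin
  refine tendsto_measure_of_ae_tendsto_indicator _ ((hmeas _).inter (measurableSet_toMeasurable _ _))
    (fun i => (hmeas _).inter (measurableSet_toMeasurable _ _))
    (measurableSet_toMeasurable volume A) (by rwa [measure_toMeasurable])
    (Eventually.of_forall fun _ => inter_subset_right) ?_
  have : ∀ᵐ p : E n, p ∈ B ∨ infDist p B ≠ r₀ := by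
    rcases eq_or_lt_of_le (show 0 ≤ r₀ from hr₀) with h | h
    · refine Eventually.of_forall fun p => or_iff_not_imp_right.2 fun hp => ?_
      rw [hBc.mem_iff_infDist_zero hB0, h]
      exact not_not.1 hp
    · have := volume_infDist_eq hB0 h
      have : ∀ᵐ p : E n, ¬ infDist p B = r₀ := by rw [ae_iff]; simpa using this
      filter_upwards [this] with p hp using Or.inr hp
  filter_upwards [this] with p hp
  have key : ∀ᶠ r in 𝓝[Ici 0] r₀, p ∈ offset B r ↔ p ∈ offset B r₀ := by
    rcases hp with hp | hp
    · filter_upwards [self_mem_nhdsWithin] with r hr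
      have h0 : infDist p B = 0 := infDist_zero_of_mem hp
      exact iff_of_true (h0.trans_le hr) (h0.trans_le hr₀)
    · rcases lt_or_gt_of_ne hp with hp | hp
      · filter_upwards [nhdsWithin_le_nhds (lt_mem_nhds hp)] with r hr
        exact iff_of_true (le_of_lt hr) hp.le
      · filter_upwards [nhdsWithin_le_nhds (gt_mem_nhds hp)] with r hr
        exact iff_of_false (not_le.2 hr) (not_le.2 hp)
  filter_upwards [key] with r hr
  simp only [mem_inter_iff, hr]

theorem radiusSet_nonempty {A B : Set (E n)} (hBc : IsClosed B) (hB0 : B.Nonempty) (hBA : B ⊆ A)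
    (hA : NullMeasurableSet A) (hAb : Bornology.IsBounded A) {t : ℝ} (ht : t ∈ Icc (0 : ℝ) 1) :
    (radiusSet t A B).Nonempty := by
  obtain ⟨b, hb⟩ := hB0
  obtain ⟨r, hr⟩ := hAb.subset_closedBall b
  have hr0 : 0 ≤ r := dist_nonneg.trans (hr (hBA hb))
  have hmono : volume.real B ≤ volume.real A := measureReal_mono hBA hAb.measure_lt_top.ne
  have h0 : offset B 0 ∩ A = B := by
    ext p
    simp only [offset, mem_inter_iff, mem_ofPred_eq]
    rw [hBc.mem_iff_infDist_zero ⟨b, hb⟩]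
    constructor
    · exact fun h => le_antisymm h.1 infDist_nonneg
    · exact fun h => ⟨h.le, hBA ((hBc.mem_iff_infDist_zero ⟨b, hb⟩).2 h)⟩
  have h1 : offset B r ∩ A = A :=
    inter_eq_right.2 fun p hp => (infDist_le_dist_of_mem hb).trans (hr hp)
  have := intermediate_value_Icc hr0
    ((continuousOn_measure_offset_inter hBc ⟨b, hb⟩ hA hAb).mono Icc_subset_Ici_self)
  simp only [h0, h1] at this
  obtain ⟨s, hs, hs'⟩ := this (show t * volume.real A + (1 - t) * volume.real B ∈ _ from
    ⟨by nlinarith [ht.1, ht.2], by nlinarith [ht.1, ht.2]⟩)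
  exact ⟨s, hs.1, hs'⟩

theorem frontier_offset_null {B : Set (E n)} (hB : RegularJordan B) (hB0 : B.Nonempty) {r : ℝ}
    (hr : 0 ≤ r) : volume (frontier (offset B r)) = 0 := by
  rcases eq_or_lt_of_le hr with h | h
  · have : offset B r = B := by
      ext p
      rw [hB.isClosed.mem_iff_infDist_zero hB0, ← h]
      exact ⟨fun h => le_antisymm h infDist_nonneg, fun h => h.le⟩
    rw [this]; exact hB.2.2
  · exact measure_mono_null (frontier_le_subset_eq (continuous_infDist_pt B) continuous_const)
      (volume_infDist_eq hB0 h)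

/-- A is only assumed bounded with null frontier, since it will be B together with a part of a
difference, which need not be regular closed. -/
theorem isAverage_simpleAverage (hn : 1 ≤ n) (c : AverageChoices n) {A B : Set (E n)}
    (hB : RegularJordan B) (hBA : B ⊆ A) (hA : Bornology.IsBounded A)
    (hAf : volume (frontier A) = 0) {t : ℝ} (ht : t ∈ Icc (0 : ℝ) 1) :
    IsAverage t A B (simpleAverage c t A B) := by
  rcases A.eq_empty_or_nonempty with rfl | hA0
  · obtain rfl : B = ∅ := subset_empty_iff.1 hBA
    have : simpleAverage c t (∅ : Set (E n)) ∅ = ∅ := by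
      unfold simpleAverage distanceAverage
      split_ifs <;> simp_all [ci]
    rw [this]
    exact ⟨.empty, EventuallyLE.refl _ _, EventuallyLE.refl _ _, by simp⟩
  unfold simpleAverage
  split_ifs with hz
  · have hz : ZeroMeasureCondition c.center A B := hz.resolve_right (not_not.2 ht)
    obtain ⟨Y, R, h, hBae⟩ := levelPair_of_subset hn c hB hBA hA hA0 hAf
    set a := fun p => relSignedDist c.center p A B
    set b := fun p => relSignedDist c.center p B A
    have hda : ∀ g, distanceAverage c.center g A B = levelSet a b g := fun g => by
      unfold distanceAverage
      rw [if_neg fun h => hA0.ne_empty h.1]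
      rfl
    have hfA := frontier_nonempty hn hA hA0
    have hone : levelSet a b 1 =ᵐ[volume] A := by
      have : levelSet a b 1 = {p | 0 ≤ signedDist p A} := by
        ext p
        simp [levelSet, a, relSignedDist, hA0.ne_empty]
      rw [this, setOf_signedDist_nonneg hfA]
      exact closure_ae_eq_of_null_frontier hAf
    have hzero : levelSet a b 0 =ᵐ[volume] B := by
      have : levelSet a b 0 = {p | 0 ≤ b p} := by
        ext p
        simp [levelSet]
      rw [this]
      exact hBae
    obtain ⟨g, hg, hgm⟩ := h.exists_measure_eq hz ht
    rw [measureReal_congr hone, measureReal_congr hzero] at hgm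
    -- The target measure is attained in [0,1], inside [-N,N] as N ≥ 1. The minimum is therefore 0,
    -- and every minimizer has the exact measure.
    have hmem : g ∈ reparamSet c.center (c.bound A B) t A B := by
      have := c.one_le_bound A B
      refine ⟨⟨by linarith [hg.1], hg.2.trans this⟩, fun ξ _ => ?_⟩
      simp only [hda, hgm, sub_self, abs_zero, mem_ofPred_eq]
      exact abs_nonneg _
    have hpar := c.param_spec t A B ⟨g, hmem⟩
    have hval := hpar.2 hmem.1
    set ξ := c.param t A B
    simp only [hda, hgm, sub_self, abs_zero, mem_ofPred_eq] at hval
    have hval := sub_eq_zero.1 (abs_eq_zero.1 (le_antisymm hval (abs_nonneg _)))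
    have hBAm : volume.real B ≤ volume.real A := measureReal_mono hBA hA.measure_lt_top.ne
    rw [hda]
    refine isAverage_of_null_frontier (isBounded_closedBall.subset (h.levelSet_subset ξ)) ?_
      (hzero.symm.le.trans (h.levelSet_zero_ae_le ?_))
      ((h.levelSet_ae_le_one ?_).trans hone.le) hval
    · refine measure_mono_null (h.frontier_levelSet_subset ξ) ?_
      by_cases hξ : ξ = 1 / 2
      · rw [hξ]; exact hz
      · exact h.measure_zero_level hξ
    · rw [measureReal_congr hzero, hval]; nlinarith [ht.1]
    · rw [measureReal_congr hone, hval]; nlinarith [ht.2]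
  · have hB0 : B.Nonempty := by
      rw [nonempty_iff_ne_empty]
      rintro rfl
      exact hz (Or.inl (zeroMeasureCondition_empty hn c hA hAf))
    obtain ⟨hr, hm⟩ := c.radius_spec t A B (radiusSet_nonempty hB.isClosed hB0 hBA
      (nullMeasurableSet_of_null_frontier hAf) hA ht)
    refine isAverage_of_null_frontier (hA.subset inter_subset_right) ?_
      (subset_inter ?_ hBA).eventuallyLE inter_subset_right.eventuallyLE hm
    · refine measure_mono_null (frontier_inter_subset _ _) (measure_union_null ?_ ?_)
      · exact measure_mono_null inter_subset_left (frontier_offset_null hB hB0 hr)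
      · exact measure_mono_null inter_subset_right hAf
    · exact fun p hp => (infDist_zero_of_mem hp).trans_le hr

/-! ### Components and nested averages -/

theorem measureReal_sdiff_of_ae_le {B S : Set (E n)} (hB : MeasurableSet B) (hS : volume S ≠ ⊤)
    (h : B ≤ᵐ[volume] S) : volume.real (S \ B) = volume.real S - volume.real B := by
  have h1 := measureReal_sdiff_add_inter hB hS
  have h2 : (S ∩ B : Set (E n)) =ᵐ[volume] B := by
    filter_upwards [h] with p hp
    exact propext ⟨fun h' => h'.2, fun h' => ⟨hp h', h'⟩⟩
  rw [measureReal_congr h2] at h1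
  linarith

/-- A limit point of T off both frontiers has a ball inside A \ B. That ball is connected and meets
T, so saturation puts it inside T. -/
theorem frontier_subset_of_union_components {A B T : Set (E n)} (hB : IsClosed B)
    (hT : T ⊆ A \ B) (hsat : ∀ x ∈ T, connectedComponentIn (A \ B) x ⊆ T) :
    frontier T ⊆ frontier A ∪ frontier B := by
  intro x hx
  by_contra hx'
  simp only [mem_union, not_or] at hx'
  have hxA : x ∈ interior A := by
    by_contra h
    exact hx'.1 ⟨closure_mono (hT.trans sdiff_subset) hx.1, h⟩
  have hxB : x ∉ B := by
    intro h
    have hxi : x ∈ interior B := by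
      by_contra h'
      exact hx'.2 ⟨subset_closure h, h'⟩
    obtain ⟨y, hy, hyT⟩ := mem_closure_iff.1 hx.1 _ isOpen_interior hxi
    exact (hT hyT).2 (interior_subset hy)
  obtain ⟨ε, hε, hball⟩ := Metric.isOpen_iff.1 (isOpen_interior.sdiff hB) x ⟨hxA, hxB⟩
  obtain ⟨y, hy, hyT⟩ := mem_closure_iff.1 hx.1 _ isOpen_ball (mem_ball_self hε)
  have hsub : ball x ε ⊆ T := by
    refine Subset.trans ?_ (hsat y hyT)
    exact (convex_ball x ε).isPreconnected.subset_connectedComponentIn hy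
      (hball.trans (sdiff_subset_sdiff interior_subset Subset.rfl))
  exact hx.2 (interior_maximal hsub isOpen_ball (mem_ball_self hε))

section Components

variable {D : Set (E n)}

theorem components_eq_of_mem {C : Set (E n)} (hC : C ∈ components D) {y : E n} (hy : y ∈ C) :
    C = connectedComponentIn D y := by
  obtain ⟨x, -, rfl⟩ := hC
  exact connectedComponentIn_eq hy

theorem components_subset {C : Set (E n)} (hC : C ∈ components D) : C ⊆ D := by
  obtain ⟨x, -, rfl⟩ := hC
  exact connectedComponentIn_subset D x

theorem components_disjoint {C C' : Set (E n)} (hC : C ∈ components D) (hC' : C' ∈ components D)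
    (h : C ≠ C') : Disjoint C C' := by
  rw [Set.disjoint_left]
  exact fun y hy hy' => h ((components_eq_of_mem hC hy).trans (components_eq_of_mem hC' hy').symm)

theorem mem_parts_iff_sUnion {ε : ℝ} {P : Set (E n)} (hP : P ∈ parts ε D) :
    ∃ K ⊆ components D, P = ⋃₀ K := by
  unfold parts at hP
  split_ifs at hP
  · exact ⟨{P}, singleton_subset_iff.2 hP, by simp⟩
  · rcases hP with hP | hP
    · exact ⟨{P}, singleton_subset_iff.2 hP.1, by simp⟩
    · exact ⟨_, fun C hC => hC.1, hP⟩

theorem parts_subset {ε : ℝ} {P : Set (E n)} (hP : P ∈ parts ε D) : P ⊆ D := by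
  obtain ⟨K, hK, rfl⟩ := mem_parts_iff_sUnion hP
  exact sUnion_subset fun C hC => components_subset (hK hC)

theorem parts_saturated {ε : ℝ} {P : Set (E n)} (hP : P ∈ parts ε D) :
    ∀ x ∈ P, connectedComponentIn D x ⊆ P := by
  obtain ⟨K, hK, rfl⟩ := mem_parts_iff_sUnion hP
  rintro x ⟨C, hC, hx⟩
  rw [← components_eq_of_mem (hK hC) hx]
  exact subset_sUnion_of_mem hC

theorem biUnion_parts (ε : ℝ) (D : Set (E n)) : ⋃ P ∈ parts ε D, P = D := by
  refine Subset.antisymm (iUnion₂_subset fun P hP => parts_subset hP) fun x hx => ?_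
  have hC : connectedComponentIn D x ∈ components D := ⟨x, hx, rfl⟩
  have hxC := mem_connectedComponentIn hx
  rw [mem_iUnion₂]
  unfold parts
  split_ifs
  · exact ⟨_, hC, hxC⟩
  · rcases le_or_gt (ENNReal.ofReal ε) (volume (connectedComponentIn D x)) with h | h
    · exact ⟨_, Or.inl ⟨hC, h⟩, hxC⟩
    · exact ⟨_, Or.inr rfl, _, ⟨hC, h⟩, hxC⟩

theorem parts_pairwiseDisjoint (ε : ℝ) (D : Set (E n)) : (parts ε D).PairwiseDisjoint id := by
  have lump : ∀ C ∈ components D, ENNReal.ofReal ε ≤ volume C →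
      Disjoint C (⋃₀ {C ∈ components D | volume C < ENNReal.ofReal ε}) := by
    intro C hC hε
    rw [disjoint_sUnion_right]
    intro C' hC'
    refine components_disjoint hC hC'.1 ?_
    rintro rfl
    exact absurd hC'.2 (not_lt.2 hε)
  intro P hP Q hQ hne
  simp only [Function.onFun, id]
  unfold parts at hP hQ
  split_ifs at hP hQ
  · exact components_disjoint hP hQ hne
  · rcases hP with hP | hP <;> rcases hQ with hQ | hQ
    · exact components_disjoint hP.1 hQ.1 hne
    · obtain rfl := hQ
      exact lump P hP.1 hP.2
    · obtain rfl := hP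
      exact (lump Q hQ.1 hQ.2).symm
    · exact absurd (Eq.trans hP (Eq.symm hQ)) hne

end Components

/-- Components of measure at least ε are disjoint within a set of finite measure; they are null
measurable because their frontiers are null. -/
theorem parts_finite {A B : Set (E n)} (hA : RegularJordan A) (hB : RegularJordan B)
    {ε : ℝ} (hε : 0 < ε) : (parts ε (A \ B)).Finite := by
  unfold parts
  split_ifs with h
  · exact h
  · refine Finite.union ?_ (finite_singleton _)
    have hnull : ∀ C : components (A \ B), NullMeasurableSet (C : Set (E n)) := by
      rintro ⟨C, hC⟩
      refine nullMeasurableSet_of_null_frontier (measure_mono_null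
        (frontier_subset_of_union_components hB.isClosed (components_subset hC) fun x hx => ?_)
        (measure_union_null hA.2.2 hB.2.2))
      rw [← components_eq_of_mem hC hx]
    have hfin := Measure.finite_const_le_meas_of_disjoint_iUnion₀ (volume : Measure (E n))
      (ENNReal.ofReal_pos.2 hε) hnull
      (fun C C' hne => (components_disjoint C.2 C'.2 (Subtype.coe_ne_coe.2 hne)).aedisjoint)
      (measure_ne_top_of_subset (s := A)
        (iUnion_subset fun C => (components_subset C.2).trans sdiff_subset) hA.measure_ne_top)
    refine (hfin.image Subtype.val).subset ?_
    rintro C ⟨hC, hCε⟩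
    exact ⟨⟨C, hC⟩, hCε, rfl⟩

theorem regularJordan_biUnion {ι : Type*} {K : Set ι} (hK : K.Finite) {f : ι → Set (E n)}
    (hf : ∀ i ∈ K, RegularJordan (f i)) : RegularJordan (⋃ i ∈ K, f i) := by
  induction K, hK using Set.Finite.induction_on with
  | empty => simpa using RegularJordan.empty
  | insert _ _ ih =>
    rw [biUnion_insert]
    exact (hf _ (mem_insert _ _)).union (ih fun i hi => hf i (mem_insert_of_mem _ hi))

/-- Outside B, the average for a part P lies a.e. in P and has measure tμ(P). The parts partition A
\ B, so the total is tμ(A \ B). -/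
theorem isAverage_nestedAverage (hn : 1 ≤ n) (c : AverageChoices n) {A B : Set (E n)}
    (hA : RegularJordan A) (hB : RegularJordan B) (hBA : B ⊆ A) {t : ℝ}
    (ht : t ∈ Icc (0 : ℝ) 1) : IsAverage t A B (nestedAverage c t A B) := by
  unfold nestedAverage
  split_ifs with hAB ht0
  · subst hAB
    exact ⟨hA, EventuallyLE.refl _ _, EventuallyLE.refl _ _, by ring⟩
  · set K := parts (c.threshold A B) (A \ B) with hK
    have hfin : K.Finite := parts_finite hA hB (c.threshold_pos A B)
    have hpf : ∀ P ∈ K, volume (frontier P) = 0 := fun P hP =>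
      measure_mono_null (frontier_subset_of_union_components hB.isClosed (parts_subset hP)
        (parts_saturated hP)) (measure_union_null hA.2.2 hB.2.2)
    have hsub : ∀ P ∈ K, B ∪ P ⊆ A := fun P hP =>
      union_subset hBA ((parts_subset hP).trans sdiff_subset)
    have hdisj : ∀ P ∈ K, Disjoint B P := fun P hP =>
      disjoint_sdiff_right.mono_right (parts_subset hP)
    have havg : ∀ P ∈ K, IsAverage t (B ∪ P) B (simpleAverage c t (B ∪ P) B) := fun P hP => by
      refine isAverage_simpleAverage hn c hB subset_union_left (hA.1.subset (hsub P hP)) ?_ ht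
      exact measure_mono_null (frontier_union_subset B P) (measure_union_null
        (measure_mono_null inter_subset_left hB.2.2) (measure_mono_null inter_subset_right
        (hpf P hP)))
    set S := fun P => simpleAverage c t (B ∪ P) B
    have hreg : RegularJordan (⋃ P ∈ K, S P) := regularJordan_biUnion hfin fun P hP =>
      (havg P hP).regular
    have hlow : B ≤ᵐ[volume] ⋃ P ∈ K, S P := by
      -- At least one part is needed: an empty union would not contain B.
      have : (A \ B).Nonempty := by
        rw [nonempty_iff_ne_empty, Ne, sdiff_eq_empty]
        exact fun h => hAB (h.antisymm hBA)
      rw [← biUnion_parts (c.threshold A B) (A \ B)] at this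
      obtain ⟨x, hx⟩ := this
      obtain ⟨P, hP, -⟩ := mem_iUnion₂.1 hx
      exact (havg P hP).lower.trans (subset_biUnion_of_mem (u := S) hP).eventuallyLE
    have hupp : ∀ᵐ p : E n, ∀ P ∈ K, p ∈ S P → p ∈ B ∪ P := by
      rw [ae_ball_iff hfin.countable]
      exact fun P hP => (havg P hP).upper
    refine ⟨hreg, hlow, ?_, ?_⟩
    · filter_upwards [hupp] with p hp hpU
      obtain ⟨P, hP, hpS⟩ := mem_iUnion₂.1 hpU
      exact hsub P hP (hp P hP hpS)
    · have hBm := hB.isClosed.measurableSet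
      have hU := measureReal_sdiff_of_ae_le hBm hreg.measure_ne_top hlow
      have hd : volume.real (A \ B) = volume.real A - volume.real B :=
        measureReal_sdiff_of_ae_le hBm hA.measure_ne_top hBA.eventuallyLE
      have hsum : volume.real ((⋃ P ∈ K, S P) \ B) = ∑ P ∈ hfin.toFinset, volume.real (S P \ B) := by
        have : (⋃ P ∈ K, S P) \ B = ⋃ P ∈ hfin.toFinset, S P \ B := by
          simp only [hfin.mem_toFinset, iUnion_sdiff]
        rw [this]
        refine measureReal_biUnion_finset₀ ?_ (fun P hP => ?_) fun P hP => ?_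
        · intro P hP Q hQ hne
          rw [hfin.coe_toFinset] at hP hQ
          have hPQ : Disjoint P Q := parts_pairwiseDisjoint _ _ hP hQ hne
          have : ∀ᵐ p : E n, ¬ (p ∈ (S P \ B) ∩ (S Q \ B)) := by
            filter_upwards [hupp] with p hp hpU
            exact Set.disjoint_left.1 hPQ ((hp P hP hpU.1.1).resolve_left hpU.1.2)
              ((hp Q hQ hpU.2.1).resolve_left hpU.2.2)
          rw [ae_iff] at this
          simp only [not_not, ofPred_mem_eq] at this
          exact this
        · have := havg P (hfin.mem_toFinset.1 hP)
          exact (this.regular.isClosed.measurableSet.diff hBm).nullMeasurableSet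
        · have := havg P (hfin.mem_toFinset.1 hP)
          exact measure_ne_top_of_subset sdiff_subset this.regular.measure_ne_top
      have hsumP : volume.real (A \ B) = ∑ P ∈ hfin.toFinset, volume.real P := by
        conv_lhs => rw [← biUnion_parts (c.threshold A B) (A \ B)]
        have : ⋃ P ∈ parts (c.threshold A B) (A \ B), P = ⋃ P ∈ hfin.toFinset, P := by
          simp only [hfin.mem_toFinset, hK]
        rw [this]
        refine measureReal_biUnion_finset₀ ?_ (fun P hP => ?_) fun P hP => ?_
        · intro P hP Q hQ hne
          rw [hfin.coe_toFinset] at hP hQ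
          exact (parts_pairwiseDisjoint _ _ hP hQ hne).aedisjoint
        · exact nullMeasurableSet_of_null_frontier (hpf P (hfin.mem_toFinset.1 hP))
        · exact measure_ne_top_of_subset (subset_union_right.trans
            (hsub P (hfin.mem_toFinset.1 hP))) hA.measure_ne_top
      have hterm : ∀ P ∈ hfin.toFinset, volume.real (S P \ B) = t * volume.real P := by
        intro P hP
        have hP := hfin.mem_toFinset.1 hP
        have := havg P hP
        rw [measureReal_sdiff_of_ae_le hBm this.regular.measure_ne_top this.lower, this.measure,
          measureReal_union' (hdisj P hP) hBm hB.measure_ne_top (measure_ne_top_of_subset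
            (subset_union_right.trans (hsub P hP)) hA.measure_ne_top)]
        ring
      rw [Finset.sum_congr rfl hterm, ← Finset.mul_sum, ← hsumP, hd, hU] at hsum
      linarith
  · exact absurd ht.1 ht0

/-! ### Symmetric difference metric and the general average -/

/-- The measure of the symmetric difference as a real number. -/
noncomputable def setDist (A B : Set (E n)) : ℝ := volume.real ((A \ B) ∪ (B \ A))

theorem setDist_comm (A B : Set (E n)) : setDist A B = setDist B A := by
  rw [setDist, setDist, union_comm]

theorem setDist_self (A : Set (E n)) : setDist A A = 0 := by simp [setDist]

theorem setDist_nonneg (A B : Set (E n)) : 0 ≤ setDist A B := measureReal_nonneg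

theorem setDist_triangle {A B C : Set (E n)} (hA : volume A ≠ ⊤) (hB : volume B ≠ ⊤)
    (hC : volume C ≠ ⊤) : setDist A C ≤ setDist A B + setDist B C := by
  refine (measureReal_mono (s₂ := (A \ B ∪ B \ A) ∪ (B \ C ∪ C \ B)) ?_ ?_).trans
    (measureReal_union_le _ _)
  · intro x; simp only [mem_union, Set.mem_sdiff]; tauto
  · refine measure_ne_top_of_subset (s := A ∪ B ∪ C) ?_
      (measure_union_ne_top (measure_union_ne_top hA hB) hC)
    intro x; simp only [mem_union, Set.mem_sdiff]; tauto

theorem setDist_eq {A B : Set (E n)} (hA : MeasurableSet A) (hB : MeasurableSet B)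
    (hA' : volume A ≠ ⊤) (hB' : volume B ≠ ⊤) :
    setDist A B = volume.real (A \ B) + volume.real (B \ A) :=
  measureReal_union (disjoint_sdiff_sdiff) (MeasurableSet.diff hB hA)
    (measure_ne_top_of_subset sdiff_subset hA') (measure_ne_top_of_subset sdiff_subset hB')

theorem measureAverage_comm (c : AverageChoices n) {t : ℝ} (ht : t ∈ Icc (0 : ℝ) 1)
    (A B : Set (E n)) : measureAverage c t A B = measureAverage c (1 - t) B A := by
  unfold measureAverage
  rw [if_neg (not_lt.2 ht.1), if_pos ht.2, if_neg (by linarith [ht.2]),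
    if_pos (by linarith [ht.1]), inter_comm B A, sub_sub_cancel, union_comm]

/-- Up to null sets D = A ∩ B, and P ∩ Q is squeezed between D and A ∩ B. Everything then follows by
inclusion-exclusion from the measures of P and Q. -/
theorem measureAverage_spec (hn : 1 ≤ n) (c : AverageChoices n) {A B : Set (E n)}
    (hA : RegularJordan A) (hB : RegularJordan B) {t : ℝ} (ht : t ∈ Icc (0 : ℝ) 1) :
    RegularJordan (measureAverage c t A B) ∧
    volume.real (measureAverage c t A B) = t * volume.real A + (1 - t) * volume.real B ∧
    setDist A (measureAverage c t A B) = (1 - t) * setDist A B := by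
  have hD := hA.ci_inter hB
  have hDae := hA.ci_inter_ae_eq hB
  have hDA : ci (A ∩ B) ⊆ A := (ci_mono inter_subset_left).trans hA.2.1.symm.subset
  have hDB : ci (A ∩ B) ⊆ B := (ci_mono inter_subset_right).trans hB.2.1.symm.subset
  have hP := isAverage_nestedAverage hn c hA hD hDA ht
  have hQ := isAverage_nestedAverage hn c hB hD hDB (t := 1 - t)
    ⟨by linarith [ht.2], by linarith [ht.1]⟩
  unfold measureAverage
  rw [if_neg (not_lt.2 ht.1), if_pos ht.2]
  set D := ci (A ∩ B)
  set P := nestedAverage c t A D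
  set Q := nestedAverage c (1 - t) B D
  clear_value D P Q
  have hAm := hA.isClosed.measurableSet
  have hBm := hB.isClosed.measurableSet
  have hDm := hD.isClosed.measurableSet
  have hPm := hP.regular.isClosed.measurableSet
  have hQm := hQ.regular.isClosed.measurableSet
  have hAf := hA.measure_ne_top
  have hBf := hB.measure_ne_top
  have hPf := hP.regular.measure_ne_top
  have hQf := hQ.regular.measure_ne_top
  have hae : ∀ᵐ p : E n, (p ∈ D ↔ p ∈ A ∧ p ∈ B) ∧ (p ∈ D → p ∈ P) ∧ (p ∈ D → p ∈ Q) ∧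
      (p ∈ P → p ∈ A) ∧ (p ∈ Q → p ∈ B) := by
    filter_upwards [hDae, hP.lower, hQ.lower, hP.upper, hQ.upper] with p h1 h2 h3 h4 h5
    exact ⟨iff_of_eq h1, h2, h3, h4, h5⟩
  -- Turns each a.e. set identity into a propositional tautology over the inclusions holding at
  -- almost every point.
  have hcongr : ∀ {U V : Set (E n)}, (∀ p, ((p ∈ D ↔ p ∈ A ∧ p ∈ B) ∧ (p ∈ D → p ∈ P) ∧
      (p ∈ D → p ∈ Q) ∧ (p ∈ P → p ∈ A) ∧ (p ∈ Q → p ∈ B)) → (p ∈ U ↔ p ∈ V)) →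
      volume.real U = volume.real V := by
    intro U V h
    refine measureReal_congr ?_
    filter_upwards [hae] with p hp
    exact propext (h p hp)
  have hinter : volume.real (P ∩ Q) = volume.real D :=
    hcongr fun p hp => by simp only [mem_inter_iff]; clear * - hp; tauto
  have hPQ := measureReal_union_add_inter (s := P) (t := Q) hQm hPf hQf
  have hmP := hP.measure
  have hmQ := hQ.measure
  refine ⟨hP.regular.union hQ.regular, by linarith, ?_⟩
  rw [setDist_eq hAm (hPm.union hQm) hAf (measure_union_ne_top hPf hQf), setDist_eq hAm hBm hAf hBf]
  have e1 : volume.real (A \ (P ∪ Q)) = volume.real A - volume.real P := by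
    rw [← measureReal_sdiff_of_ae_le hPm hAf hP.upper]
    exact hcongr fun p hp => by simp only [Set.mem_sdiff, mem_union]; clear * - hp; tauto
  have e2 : volume.real ((P ∪ Q) \ A) = volume.real Q - volume.real D := by
    rw [← measureReal_sdiff_of_ae_le hDm hQf hQ.lower]
    exact hcongr fun p hp => by simp only [Set.mem_sdiff, mem_union]; clear * - hp; tauto
  have e3 : volume.real (A \ B) = volume.real A - volume.real D := by
    rw [← measureReal_sdiff_of_ae_le hDm hAf hDA.eventuallyLE]
    exact hcongr fun p hp => by simp only [Set.mem_sdiff]; clear * - hp; tauto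
  have e4 : volume.real (B \ A) = volume.real B - volume.real D := by
    rw [← measureReal_sdiff_of_ae_le hDm hBf hDB.eventuallyLE]
    exact hcongr fun p hp => by simp only [Set.mem_sdiff]; clear * - hp; tauto
  rw [e1, e2, e3, e4, hmP, hmQ]
  ring

theorem setDist_measureAverage_right (hn : 1 ≤ n) (c : AverageChoices n) {A B : Set (E n)}
    (hA : RegularJordan A) (hB : RegularJordan B) {t : ℝ} (ht : t ∈ Icc (0 : ℝ) 1) :
    setDist B (measureAverage c t A B) = t * setDist A B := by
  rw [measureAverage_comm c ht, (measureAverage_spec hn c hB hA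
    ⟨by linarith [ht.2], by linarith [ht.1]⟩).2.2, setDist_comm B A, sub_sub_cancel]

/-! ### Contraction of the set-valued scheme -/

section Regularity

variable {c : AverageChoices n} {F : ℤ → Set (E n)}

theorem regularJordan_doubled (hn : 1 ≤ n) (hF : ∀ i, RegularJordan (F i)) (i : ℤ) :
    RegularJordan (doubled c F i) := by
  unfold doubled
  split_ifs
  · exact hF _
  · exact (measureAverage_spec hn c (hF _) (hF _) ⟨by norm_num, by norm_num⟩).1

theorem regularJordan_averaged (hn : 1 ≤ n) (hF : ∀ i, RegularJordan (F i)) (i : ℤ) :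
    RegularJordan (averaged c F i) :=
  (measureAverage_spec hn c (hF _) (hF _) ⟨by norm_num, by norm_num⟩).1

theorem regularJordan_averaged_iterate (hn : 1 ≤ n) (hF : ∀ i, RegularJordan (F i)) (j : ℕ) :
    ∀ i, RegularJordan ((averaged c)^[j] F i) := by
  induction j with
  | zero => exact hF
  | succ j ih =>
    rw [Function.iterate_succ_apply']
    exact regularJordan_averaged hn ih

theorem regularJordan_refineSets (hn : 1 ≤ n) (m : ℕ) (hF : ∀ i, RegularJordan (F i)) (i : ℤ) :
    RegularJordan (refineSets c m F i) :=
  regularJordan_averaged_iterate hn (regularJordan_doubled hn hF) _ _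

theorem regularJordan_refineSets_iterate (hn : 1 ≤ n) (m : ℕ) (hF : ∀ i, RegularJordan (F i))
    (k : ℕ) : ∀ i, RegularJordan ((refineSets c m)^[k] F i) := by
  induction k with
  | zero => exact hF
  | succ k ih =>
    rw [Function.iterate_succ_apply']
    exact regularJordan_refineSets hn m ih

end Regularity

/-- Consecutive sets with indices in `[a, b]` are at distance at most `δ`. -/
def StepBound (F : ℤ → Set (E n)) (a b : ℤ) (δ : ℝ) : Prop :=
  ∀ i, a ≤ i → i < b → setDist (F i) (F (i + 1)) ≤ δ

theorem StepBound.mono {F : ℤ → Set (E n)} {a b a' b' : ℤ} {δ : ℝ} (h : StepBound F a b δ)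
    (ha : a ≤ a') (hb : b' ≤ b) : StepBound F a' b' δ :=
  fun i hi hi' => h i (ha.trans hi) (hi'.trans_le hb)

theorem StepBound.setDist_le {F : ℤ → Set (E n)} (hF : ∀ i, RegularJordan (F i)) {a b : ℤ} {δ : ℝ}
    (h : StepBound F a b δ) {i : ℤ} (hi : a ≤ i) (d : ℕ) (hd : i + d ≤ b) :
    setDist (F i) (F (i + d)) ≤ d * δ := by
  induction d with
  | zero => simp [setDist_self]
  | succ d ih =>
    push_cast at hd ⊢
    have h1 := ih (by linarith)
    have h2 := h (i + d) (by linarith [Int.natCast_nonneg d]) (by linarith)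
    have h3 := setDist_triangle (hF i).measure_ne_top (hF (i + d)).measure_ne_top
      (hF (i + d + 1)).measure_ne_top
    rw [← add_assoc]
    linarith

section Contraction

variable {c : AverageChoices n} {F : ℤ → Set (E n)} {a b : ℤ} {δ : ℝ}

theorem setDist_left_half (hn : 1 ≤ n) (hF : ∀ i, RegularJordan (F i)) (i : ℤ) :
    setDist (F i) (measureAverage c (1 / 2) (F i) (F (i + 1))) =
      setDist (F i) (F (i + 1)) / 2 := by
  rw [(measureAverage_spec hn c (hF _) (hF _) ⟨by norm_num, by norm_num⟩).2.2]
  ring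

theorem setDist_right_half (hn : 1 ≤ n) (hF : ∀ i, RegularJordan (F i)) (i : ℤ) :
    setDist (F (i + 1)) (measureAverage c (1 / 2) (F i) (F (i + 1))) =
      setDist (F i) (F (i + 1)) / 2 := by
  rw [setDist_measureAverage_right hn c (hF _) (hF _) ⟨by norm_num, by norm_num⟩]
  ring

theorem doubled_two_mul (i : ℤ) : doubled c F (2 * i) = F i := by
  rw [doubled, if_pos (even_two_mul i), Int.mul_ediv_cancel_left _ two_ne_zero]

theorem doubled_two_mul_add_one (i : ℤ) :
    doubled c F (2 * i + 1) = measureAverage c (1 / 2) (F i) (F (i + 1)) := by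
  have : (2 * i + 1) / 2 = i := by omega
  rw [doubled, if_neg (by simp), this]

theorem StepBound.doubled (hn : 1 ≤ n) (hF : ∀ i, RegularJordan (F i)) (h : StepBound F a b δ) :
    StepBound (doubled c F) (2 * a) (2 * b) (δ / 2) := by
  intro i hi hi'
  obtain ⟨j, rfl | rfl⟩ := Int.even_or_odd' i
  · rw [doubled_two_mul, doubled_two_mul_add_one, setDist_left_half hn hF]
    linarith [h j (by omega) (by omega)]
  · rw [doubled_two_mul_add_one, show 2 * j + 1 + 1 = 2 * (j + 1) by ring, doubled_two_mul,
      setDist_comm, setDist_right_half hn hF]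
    linarith [h j (by omega) (by omega)]

/-- Consecutive midpoints are linked through the shared set `F (i + 1)`, half a step from each. The
step does not grow, and one index is lost on the right. -/
theorem StepBound.averaged (hn : 1 ≤ n) (hF : ∀ i, RegularJordan (F i)) (h : StepBound F a b δ) :
    StepBound (averaged c F) a (b - 1) δ := by
  intro i hi hi'
  have h1 := h i hi (by omega)
  have h2 := h (i + 1) (by omega) (by omega)
  have h3 := setDist_right_half (c := c) hn hF i
  have h4 := setDist_left_half (c := c) hn hF (i + 1)
  rw [setDist_comm] at h3
  have := setDist_triangle (regularJordan_averaged (c := c) hn hF i).measure_ne_top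
    (hF (i + 1)).measure_ne_top (regularJordan_averaged (c := c) hn hF (i + 1)).measure_ne_top
  simp only [SetSpline.averaged] at this ⊢
  linarith

theorem StepBound.averaged_iterate (hn : 1 ≤ n) (hF : ∀ i, RegularJordan (F i))
    (h : StepBound F a b δ) (j : ℕ) : StepBound ((SetSpline.averaged c)^[j] F) a (b - j) δ := by
  induction j with
  | zero => simpa using h
  | succ j ih =>
    rw [Function.iterate_succ_apply']
    refine (ih.averaged hn (regularJordan_averaged_iterate hn hF j)).mono le_rfl ?_
    push_cast; linarith

theorem StepBound.setDist_averaged_iterate_le (hn : 1 ≤ n) (hF : ∀ i, RegularJordan (F i))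
    (h : StepBound F a b δ) {i : ℤ} (hi : a ≤ i) (j : ℕ) (hj : i + j ≤ b) :
    setDist (F i) ((SetSpline.averaged c)^[j] F i) ≤ j * (δ / 2) := by
  induction j with
  | zero => simp [setDist_self]
  | succ j ih =>
    push_cast at hj ⊢
    have h1 := ih (by linarith)
    have hG := regularJordan_averaged_iterate (c := c) hn hF j
    have h2 := h.averaged_iterate (c := c) hn hF j i hi (by linarith)
    have h3 := setDist_left_half (c := c) hn hG i
    rw [Function.iterate_succ_apply']
    have := setDist_triangle (hF i).measure_ne_top (hG i).measure_ne_top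
      (regularJordan_averaged (c := c) hn hG i).measure_ne_top
    simp only [SetSpline.averaged] at this ⊢
    linarith

theorem shift_bounds {m : ℕ} (hm : 1 ≤ m) :
    0 ≤ ⌊((m : ℚ) - 1) / 2⌋ ∧ ⌊((m : ℚ) - 1) / 2⌋ ≤ (m : ℤ) - 1 := by
  have hm' : (1 : ℚ) ≤ m := by exact_mod_cast hm
  refine ⟨Int.floor_nonneg.2 (by linarith), ?_⟩
  have h1 := Int.floor_le (((m : ℚ) - 1) / 2)
  have h2 : ((⌊((m : ℚ) - 1) / 2⌋ : ℤ) : ℚ) ≤ ((m : ℤ) - 1 : ℤ) := by push_cast; linarith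
  exact_mod_cast h2

/-- A window of m+1 indices on each side reproduces itself: doubling its width pays for the m-1
indices lost to averaging and for the shift. -/
theorem StepBound.refineSets (hn : 1 ≤ n) {m : ℕ} (hm : 1 ≤ m) (hF : ∀ i, RegularJordan (F i))
    {p q : ℤ} (hq : q = 2 * p ∨ q = 2 * p + 1)
    (h : StepBound F (p - (m + 1)) (p + (m + 1)) δ) :
    StepBound (refineSets c m F) (q - (m + 1)) (q + (m + 1)) (δ / 2) := by
  obtain ⟨hs, hs'⟩ := shift_bounds hm
  intro i hi hi'
  have h1 := (h.doubled (c := c) hn hF).averaged_iterate (c := c) hn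
    (regularJordan_doubled hn hF) (m - 1)
  have h2 := h1 (i - ⌊((m : ℚ) - 1) / 2⌋) (by omega) (by omega)
  unfold SetSpline.refineSets
  rwa [show i + 1 - ⌊((m : ℚ) - 1) / 2⌋ = i - ⌊((m : ℚ) - 1) / 2⌋ + 1 by ring]

/-- F p sits at index 2p after doubling, at most m half-steps from the starting index q - s. The m-1
averagings then move a set by δ/4 each. -/
theorem StepBound.setDist_refineSets_le (hn : 1 ≤ n) {m : ℕ} (hm : 1 ≤ m)
    (hF : ∀ i, RegularJordan (F i)) {p q : ℤ} (hq : q = 2 * p ∨ q = 2 * p + 1)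
    (h : StepBound F (p - (m + 1)) (p + (m + 1)) δ) :
    setDist (F p) (SetSpline.refineSets c m F q) ≤ m * δ := by
  obtain ⟨hs, hs'⟩ := shift_bounds hm
  have hδ : 0 ≤ δ := (setDist_nonneg _ _).trans (h p (by omega) (by omega))
  have hD := regularJordan_doubled (c := c) hn hF
  have hb := h.doubled (c := c) hn hF
  set s := ⌊((m : ℚ) - 1) / 2⌋
  have hm1 : ((m - 1 : ℕ) : ℝ) = m - 1 := by push_cast [hm]; ring
  have h1 := hb.setDist_averaged_iterate_le (c := c) hn hD (i := q - s) (by omega) (m - 1)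
    (by omega)
  rw [hm1] at h1
  have h2 : setDist (F p) (SetSpline.doubled c F (q - s)) ≤ m * (δ / 2) := by
    rw [← doubled_two_mul (c := c) (F := F) p]
    rcases le_total (2 * p) (q - s) with hle | hle
    · obtain ⟨d, hd⟩ := Int.eq_ofNat_of_zero_le (sub_nonneg.2 hle)
      have hdm : (d : ℝ) ≤ m := by
        have : d ≤ m := by omega
        exact_mod_cast this
      have h3 := hb.setDist_le hD (i := 2 * p) (by omega) d (by omega)
      rw [show 2 * p + (d : ℤ) = q - s by omega] at h3
      exact h3.trans (mul_le_mul_of_nonneg_right hdm (by linarith))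
    · obtain ⟨d, hd⟩ := Int.eq_ofNat_of_zero_le (sub_nonneg.2 hle)
      have hdm : (d : ℝ) ≤ m := by
        have : d ≤ m := by omega
        exact_mod_cast this
      have h3 := hb.setDist_le hD (i := q - s) (by omega) d (by omega)
      rw [show q - s + (d : ℤ) = 2 * p by omega] at h3
      rw [setDist_comm]
      exact h3.trans (mul_le_mul_of_nonneg_right hdm (by linarith))
  have h3 := setDist_triangle (hF p).measure_ne_top (hD (q - s)).measure_ne_top
    (regularJordan_refineSets (c := c) hn m hF q).measure_ne_top
  have h4 : ((m : ℝ) - 1) * (δ / 2 / 2) ≤ m * (δ / 2) := by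
    have : (0 : ℝ) ≤ m * δ := by positivity
    nlinarith
  have h5 : SetSpline.refineSets c m F q =
    (SetSpline.averaged c)^[m - 1] (SetSpline.doubled c F) (q - s) := rfl
  rw [h5] at h3 ⊢
  linarith

end Contraction

/-- The initial steps may be unbounded over all indices; a finite window suffices at each x. -/
theorem exists_stepBound (F : ℤ → Set (E n)) (a b : ℤ) : ∃ δ, 0 ≤ δ ∧ StepBound F a b δ := by
  refine ⟨∑ i ∈ Finset.Ico a b, setDist (F i) (F (i + 1)),
    Finset.sum_nonneg fun i _ => setDist_nonneg _ _, fun i hi hi' => ?_⟩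
  exact Finset.single_le_sum (f := fun i => setDist (F i) (F (i + 1)))
    (fun i _ => setDist_nonneg _ _) (Finset.mem_Ico.2 ⟨hi, hi'⟩)

theorem floor_mul_two_pow_succ (x : ℝ) (k : ℕ) :
    ⌊x * 2 ^ (k + 1)⌋ = 2 * ⌊x * 2 ^ k⌋ ∨ ⌊x * 2 ^ (k + 1)⌋ = 2 * ⌊x * 2 ^ k⌋ + 1 := by
  have h1 := Int.floor_le (x * 2 ^ k)
  have h2 := Int.lt_floor_add_one (x * 2 ^ k)
  have h3 : x * 2 ^ (k + 1) = 2 * (x * 2 ^ k) := by ring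
  rw [h3]
  have h4 : 2 * ⌊x * 2 ^ k⌋ ≤ ⌊2 * (x * 2 ^ k)⌋ := by
    rw [Int.le_floor]; push_cast; linarith
  have h5 : ⌊2 * (x * 2 ^ k)⌋ < 2 * ⌊x * 2 ^ k⌋ + 2 := by
    rw [Int.floor_lt]; push_cast; linarith
  omega

theorem weight_mem_Icc (y : ℝ) : (⌊y⌋ : ℝ) + 1 - y ∈ Icc (0 : ℝ) 1 :=
  ⟨by linarith [Int.lt_floor_add_one y], by linarith [Int.floor_le y]⟩

theorem stepBound_refineSets_iterate (hn : 1 ≤ n) {m : ℕ} (hm : 1 ≤ m) {c : AverageChoices n}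
    {F : ℤ → Set (E n)} (hF : ∀ i, RegularJordan (F i)) {x δ : ℝ}
    (h : StepBound F (⌊x⌋ - (m + 1)) (⌊x⌋ + (m + 1)) δ) (k : ℕ) :
    StepBound ((refineSets c m)^[k] F) (⌊x * 2 ^ k⌋ - (m + 1)) (⌊x * 2 ^ k⌋ + (m + 1))
      (δ / 2 ^ k) := by
  induction k with
  | zero => simpa using h
  | succ k ih =>
    rw [Function.iterate_succ_apply', pow_succ, ← div_div, ← pow_succ]
    exact ih.refineSets hn hm (regularJordan_refineSets_iterate hn m hF k)
      (floor_mul_two_pow_succ x k)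

theorem regularJordan_setInterpolant (hn : 1 ≤ n) (m : ℕ) (c : AverageChoices n)
    {F : ℤ → Set (E n)} (hF : ∀ i, RegularJordan (F i)) (k : ℕ) (x : ℝ) :
    RegularJordan (setInterpolant c m F k x) :=
  (measureAverage_spec hn c (regularJordan_refineSets_iterate hn m hF k _)
    (regularJordan_refineSets_iterate hn m hF k _) (weight_mem_Icc _)).1

theorem exists_setDist_setInterpolant_le (hn : 1 ≤ n) {m : ℕ} (hm : 1 ≤ m) (c : AverageChoices n)
    {F : ℤ → Set (E n)} (hF : ∀ i, RegularJordan (F i)) (x : ℝ) :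
    ∃ C, ∀ k, setDist (setInterpolant c m F k x) (setInterpolant c m F (k + 1) x) ≤
      C * (1 / 2) ^ k := by
  obtain ⟨δ, hδ, h⟩ := exists_stepBound F (⌊x⌋ - (m + 1)) (⌊x⌋ + (m + 1))
  have hstep := stepBound_refineSets_iterate (c := c) hn hm hF h
  have hreg := regularJordan_refineSets_iterate (c := c) hn m hF
  have hnear : ∀ k, setDist ((refineSets c m)^[k] F ⌊x * 2 ^ k⌋) (setInterpolant c m F k x) ≤
      δ / 2 ^ k := by
    intro k
    have hw := weight_mem_Icc (x * 2 ^ k)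
    rw [setInterpolant, (measureAverage_spec hn c (hreg k _) (hreg k _) hw).2.2]
    have h1 := hstep k ⌊x * 2 ^ k⌋ (by omega) (by omega)
    have h2 := setDist_nonneg ((refineSets c m)^[k] F ⌊x * 2 ^ k⌋)
      ((refineSets c m)^[k] F (⌊x * 2 ^ k⌋ + 1))
    nlinarith [hw.1, hw.2]
  -- The path runs through the left nodes of both levels: m for the distance between them, and one
  -- for each interpolant's distance to its own node.
  refine ⟨(m + 2) * δ, fun k => ?_⟩
  have h1 := hnear k
  have h2 := hnear (k + 1)
  have h3 := (hstep k).setDist_refineSets_le (c := c) hn hm (hreg k) (floor_mul_two_pow_succ x k)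
  rw [← Function.iterate_succ_apply' (refineSets c m)] at h3
  have hI := regularJordan_setInterpolant hn m c hF
  have t1 := setDist_triangle (hI k x).measure_ne_top (hreg k ⌊x * 2 ^ k⌋).measure_ne_top
    (hI (k + 1) x).measure_ne_top
  have t2 := setDist_triangle (hreg k ⌊x * 2 ^ k⌋).measure_ne_top
    (hreg (k + 1) ⌊x * 2 ^ (k + 1)⌋).measure_ne_top (hI (k + 1) x).measure_ne_top
  rw [setDist_comm (setInterpolant c m F k x) ((refineSets c m)^[k] F _)] at t1
  have h4 : δ / 2 ^ (k + 1) ≤ δ / 2 ^ k := by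
    refine div_le_div_of_nonneg_left hδ (by positivity) ?_
    exact pow_le_pow_right₀ one_le_two (Nat.le_succ k)
  have h5 : (m + 2) * δ * (1 / 2) ^ k = m * (δ / 2 ^ k) + δ / 2 ^ k + δ / 2 ^ k := by
    rw [div_pow, one_pow]; ring
  rw [h5]
  linarith

/-! ### Completeness and continuity of measure -/

theorem ofReal_setDist {A B : Set (E n)} (hA : volume A ≠ ⊤) (hB : volume B ≠ ⊤) :
    ENNReal.ofReal (setDist A B) = dMu A B :=
  ENNReal.ofReal_toReal (measure_union_ne_top (measure_ne_top_of_subset sdiff_subset hA)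
    (measure_ne_top_of_subset sdiff_subset hB))

/-- Completeness of the symmetric difference metric, for geometrically Cauchy sequences. -/
theorem exists_tendsto_dMu {S : ℕ → Set (E n)} (hm : ∀ k, MeasurableSet (S k))
    (hf : ∀ k, volume (S k) ≠ ⊤) {C : ℝ}
    (h : ∀ k, setDist (S k) (S (k + 1)) ≤ C * (1 / 2) ^ k) :
    ∃ T, LebesgueFinite T ∧ Tendsto (fun k => dMu (S k) T) atTop (𝓝 0) := by
  set T : Set (E n) := ⋂ N, ⋃ k, S (k + N) with hT
  have hTm : MeasurableSet T := .iInter fun N => .iUnion fun k => hm _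
  have hsum : ∑' k : ℕ, ENNReal.ofReal (C * (1 / 2) ^ k) ≠ ⊤ :=
    (summable_geometric_two.mul_left C).tsum_ofReal_ne_top
  have hle : ∀ k, dMu (S k) T ≤ ∑' j, ENNReal.ofReal (C * (1 / 2) ^ (j + k)) := by
    intro k
    -- T is the limit superior. A point that never changes membership after stage k lies in T
    -- exactly when it lies in S k, so the discrepancy is covered by the later increments.
    have hsub : (S k \ T) ∪ (T \ S k) ⊆
        ⋃ j, (S (j + k) \ S (j + k + 1)) ∪ (S (j + k + 1) \ S (j + k)) := by
      intro p hp
      by_contra hp'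
      rw [mem_iUnion, not_exists] at hp'
      have hall : ∀ j, p ∈ S (j + k) ↔ p ∈ S k := by
        intro j
        induction j with
        | zero => simp
        | succ j ih =>
          rw [← ih, show j + 1 + k = j + k + 1 by ring]
          have := hp' j
          simp only [mem_union, Set.mem_sdiff] at this
          tauto
      have hiff : p ∈ T ↔ p ∈ S k := by
        simp only [hT, mem_iInter, mem_iUnion]
        constructor
        · intro h'
          obtain ⟨i, hi⟩ := h' k
          exact (hall i).1 hi
        · intro h' N
          exact ⟨k, by rw [add_comm]; exact (hall N).2 h'⟩
      simp only [mem_union, Set.mem_sdiff] at hp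
      tauto
    refine (measure_mono hsub).trans ((measure_iUnion_le _).trans (ENNReal.tsum_le_tsum fun j => ?_))
    have := ENNReal.ofReal_le_ofReal (h (j + k))
    rwa [ofReal_setDist (hf _) (hf _)] at this
  have htend : Tendsto (fun k => dMu (S k) T) atTop (𝓝 0) :=
    tendsto_of_tendsto_of_tendsto_of_le_of_le tendsto_const_nhds
      (ENNReal.tendsto_sum_nat_add _ hsum) (fun _ => zero_le) hle
  refine ⟨T, ⟨hTm.nullMeasurableSet, ?_⟩, htend⟩
  have h0 : dMu (S 0) T ≠ ⊤ := ((hle 0).trans_lt (by simpa using hsum.lt_top)).ne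
  refine (measure_mono (t := S 0 ∪ ((S 0 \ T) ∪ (T \ S 0))) ?_).trans_lt
    (measure_union_ne_top (hf 0) h0).lt_top
  intro p hp
  by_cases h' : p ∈ S 0
  · exact Or.inl h'
  · exact Or.inr (Or.inr ⟨hp, h'⟩)

theorem abs_measureReal_sub_le {A B : Set (E n)} (hA : volume A ≠ ⊤) (hB : volume B ≠ ⊤) :
    |volume.real A - volume.real B| ≤ (dMu A B).toReal := by
  have key : ∀ {A B : Set (E n)}, volume A ≠ ⊤ → volume B ≠ ⊤ →
      volume.real A ≤ volume.real B + setDist A B := by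
    intro A B hA hB
    refine (measureReal_mono (s₂ := B ∪ (A \ B ∪ B \ A)) ?_ ?_).trans (measureReal_union_le _ _)
    · intro p hp
      by_cases h : p ∈ B
      · exact Or.inl h
      · exact Or.inr (Or.inl ⟨hp, h⟩)
    · exact measure_union_ne_top hB (measure_union_ne_top (measure_ne_top_of_subset sdiff_subset hA)
        (measure_ne_top_of_subset sdiff_subset hB))
  have h1 := key hA hB
  have h2 := key hB hA
  rw [setDist_comm] at h2
  change _ ≤ setDist A B
  rw [abs_le]
  constructor <;> linarith

theorem tendsto_measureReal_of_tendsto_dMu {S : ℕ → Set (E n)} {T : Set (E n)}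
    (hS : ∀ k, volume (S k) ≠ ⊤) (hT : volume T ≠ ⊤)
    (h : Tendsto (fun k => dMu (S k) T) atTop (𝓝 0)) :
    Tendsto (fun k => volume.real (S k)) atTop (𝓝 (volume.real T)) := by
  rw [tendsto_iff_norm_sub_tendsto_zero]
  have h' := (ENNReal.tendsto_toReal ENNReal.zero_ne_top).comp h
  exact squeeze_zero (fun _ => norm_nonneg _) (fun k => abs_measureReal_sub_le (hS k) hT) h'

/-! ### Factorization of the real spline scheme -/

section RealScheme

/-- The doubling and first averaging step for real data. -/
noncomputable def doubledReal (f : ℤ → ℝ) : ℤ → ℝ :=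
  fun i => if Even i then f (i / 2) else (f (i / 2) + f (i / 2 + 1)) / 2

/-- One averaging step for real data. -/
noncomputable def averagedReal (f : ℤ → ℝ) : ℤ → ℝ := fun i => (f i + f (i + 1)) / 2

theorem mask_of_neg (m : ℕ) {l : ℤ} (hl : l < 0) : mask m l = 0 :=
  if_neg fun h => absurd h.1 (not_le.2 hl)

theorem mask_natCast (m l : ℕ) : mask m l = ((m + 1).choose l : ℝ) / 2 ^ m := by
  unfold mask
  split_ifs with h
  · simp
  · rw [Nat.choose_eq_zero_of_lt (by omega)]; simp

/-- Pascal's rule: one more midpoint averaging raises the degree by one. The index l = -1 is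
separate, since one neighbour falls outside the binomial range. -/
theorem mask_succ (m : ℕ) (l : ℤ) : mask (m + 1) (l + 1) = (mask m l + mask m (l + 1)) / 2 := by
  rcases lt_or_ge l 0 with hl | hl
  · rcases eq_or_lt_of_le (show l + 1 ≤ 0 by omega) with h | h
    · rw [h, mask_of_neg m hl]
      have h1 := mask_natCast m 0
      have h2 := mask_natCast (m + 1) 0
      simp only [Nat.cast_zero, Nat.choose_zero_right] at h1 h2
      rw [h1, h2, pow_succ]
      field_simp
      simp
    · rw [mask_of_neg m hl, mask_of_neg m h, mask_of_neg _ h]; simp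
  · obtain ⟨d, rfl⟩ := Int.eq_ofNat_of_zero_le hl
    have : ((d : ℤ) + 1) = ((d + 1 : ℕ) : ℤ) := by push_cast; ring
    rw [this, mask_natCast, mask_natCast, mask_natCast, Nat.choose_succ_succ (m + 1) d, pow_succ]
    push_cast
    field_simp

theorem mask_support_finite (m : ℕ) (c : ℤ) (f : ℤ → ℝ) :
    (Function.support fun j : ℤ => mask m (c - 2 * j) * f j).Finite := by
  refine (finite_Icc (c - 2 * (m + 1) - c.natAbs) (c.natAbs)).subset fun j hj => ?_
  rw [Function.mem_support] at hj
  have h : 0 ≤ c - 2 * j ∧ c - 2 * j ≤ (m : ℤ) + 1 := by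
    by_contra h
    exact hj (by rw [mask, if_neg h, zero_mul])
  rw [mem_Icc]
  omega

theorem finsum_mask_one (f : ℤ → ℝ) (i : ℤ) :
    ∑ᶠ j : ℤ, mask 1 (1 + i - 2 * j) * f j = doubledReal f i := by
  have h0 : mask 1 0 = 1 / 2 := by simpa using mask_natCast 1 0
  have h1 : mask 1 1 = 1 := by simpa using mask_natCast 1 1
  have h2 : mask 1 2 = 1 / 2 := by simpa using mask_natCast 1 2
  have hsupp : ∀ j, j ∉ Finset.Icc (i / 2) (i / 2 + 1) → mask 1 (1 + i - 2 * j) * f j = 0 := by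
    intro j hj
    rw [Finset.mem_Icc] at hj
    rw [mask, if_neg (by push_cast; omega), zero_mul]
  rw [finsum_eq_sum_of_support_subset (s := Finset.Icc (i / 2) (i / 2 + 1)) _ (fun j hj => by
    by_contra h; exact hj (hsupp j h))]
  have hIcc : Finset.Icc (i / 2) (i / 2 + 1) = {i / 2, i / 2 + 1} := by
    ext j; simp only [Finset.mem_Icc, Finset.mem_insert, Finset.mem_singleton]; omega
  rw [hIcc, Finset.sum_pair (by omega), doubledReal]
  obtain ⟨q, rfl | rfl⟩ := Int.even_or_odd' i
  · rw [if_pos (even_two_mul q), Int.mul_ediv_cancel_left _ two_ne_zero,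
      show 1 + 2 * q - 2 * q = 1 by ring, mask_of_neg 1 (l := 1 + 2 * q - 2 * (q + 1)) (by omega), h1]
    ring
  · have : (2 * q + 1) / 2 = q := by omega
    rw [if_neg (by simp), this, show 1 + (2 * q + 1) - 2 * q = 2 by ring,
      show 1 + (2 * q + 1) - 2 * (q + 1) = 0 by ring, h0, h2]
    ring

theorem finsum_mask_eq_averagedReal_iterate (f : ℤ → ℝ) (m : ℕ) (i : ℤ) :
    ∑ᶠ j : ℤ, mask (m + 1) ((m : ℤ) + 1 + i - 2 * j) * f j =
      averagedReal^[m] (doubledReal f) i := by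
  induction m generalizing i with
  | zero => simpa using finsum_mask_one f i
  | succ m ih =>
    rw [Function.iterate_succ_apply', averagedReal, ← ih, ← ih, ← finsum_add_distrib
      (mask_support_finite _ _ _) (mask_support_finite _ _ _), div_eq_mul_inv, finsum_mul]
    refine finsum_congr fun j => ?_
    rw [show ((m + 1 : ℕ) : ℤ) + 1 + i - 2 * j = (m : ℤ) + 1 + i - 2 * j + 1 by push_cast; ring,
      mask_succ, show (m : ℤ) + 1 + (i + 1) - 2 * j = (m : ℤ) + 1 + i - 2 * j + 1 by ring]
    ring

/-- The centrings agree because ⌈(m+1)/2⌉ = m - ⌊(m-1)/2⌋. -/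
theorem refineReal_eq_averagedReal_iterate {m : ℕ} (hm : 1 ≤ m) (f : ℤ → ℝ) (i : ℤ) :
    refineReal m f i =
      averagedReal^[m - 1] (doubledReal f) (i - ⌊((m : ℚ) - 1) / 2⌋) := by
  obtain ⟨d, rfl⟩ : ∃ d, m = d + 1 := ⟨m - 1, by omega⟩
  have hceil : ⌈(((d + 1 : ℕ) : ℚ) + 1) / 2⌉ =
      (d : ℤ) + 1 - ⌊(((d + 1 : ℕ) : ℚ) - 1) / 2⌋ := by
    have : (((d + 1 : ℕ) : ℚ) + 1) / 2 =
        -((((d + 1 : ℕ) : ℚ) - 1) / 2) + ((d + 1 : ℤ) : ℚ) := by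
      push_cast; ring
    rw [this, Int.ceil_add_intCast, Int.ceil_neg]
    ring
  rw [Nat.add_sub_cancel, ← finsum_mask_eq_averagedReal_iterate, refineReal, hceil]
  refine finsum_congr fun j => ?_
  congr 2
  ring

end RealScheme

/-! ### Comparison of the two schemes -/

section Comparison

variable {c : AverageChoices n} {F : ℤ → Set (E n)}

theorem measureReal_doubled (hn : 1 ≤ n) (hF : ∀ i, RegularJordan (F i)) (i : ℤ) :
    volume.real (doubled c F i) = doubledReal (fun i => volume.real (F i)) i := by
  unfold doubled doubledReal
  split_ifs
  · rfl
  · rw [(measureAverage_spec hn c (hF _) (hF _) ⟨by norm_num, by norm_num⟩).2.1]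
    ring

theorem measureReal_averaged (hn : 1 ≤ n) (hF : ∀ i, RegularJordan (F i)) (i : ℤ) :
    volume.real (averaged c F i) = averagedReal (fun i => volume.real (F i)) i := by
  unfold averaged averagedReal
  rw [(measureAverage_spec hn c (hF _) (hF _) ⟨by norm_num, by norm_num⟩).2.1]
  ring

theorem measureReal_averaged_iterate (hn : 1 ≤ n) (hF : ∀ i, RegularJordan (F i)) (j : ℕ) :
    (fun i => volume.real ((averaged c)^[j] F i)) =
      averagedReal^[j] (fun i => volume.real (F i)) := by
  induction j with
  | zero => rfl
  | succ j ih =>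
    rw [Function.iterate_succ_apply', Function.iterate_succ_apply', ← ih]
    exact funext fun i => measureReal_averaged hn (regularJordan_averaged_iterate hn hF j) i

theorem measureReal_refineSets (hn : 1 ≤ n) {m : ℕ} (hm : 1 ≤ m)
    (hF : ∀ i, RegularJordan (F i)) :
    (fun i => volume.real (refineSets c m F i)) = refineReal m (fun i => volume.real (F i)) := by
  funext i
  rw [refineReal_eq_averagedReal_iterate hm,
    ← funext (measureReal_doubled (c := c) hn hF),
    ← measureReal_averaged_iterate hn (regularJordan_doubled hn hF)]
  rfl

theorem measureReal_refineSets_iterate (hn : 1 ≤ n) {m : ℕ} (hm : 1 ≤ m)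
    (hF : ∀ i, RegularJordan (F i)) (k : ℕ) :
    (fun i => volume.real ((refineSets c m)^[k] F i)) =
      (refineReal m)^[k] (fun i => volume.real (F i)) := by
  induction k with
  | zero => rfl
  | succ k ih =>
    rw [Function.iterate_succ_apply', Function.iterate_succ_apply', ← ih]
    exact measureReal_refineSets hn hm (regularJordan_refineSets_iterate hn m hF k)

theorem measureReal_setInterpolant (hn : 1 ≤ n) {m : ℕ} (hm : 1 ≤ m)
    (hF : ∀ i, RegularJordan (F i)) (k : ℕ) (x : ℝ) :
    volume.real (setInterpolant c m F k x) =
      realInterpolant m (fun i => volume.real (F i)) k x := by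
  have hreg := regularJordan_refineSets_iterate (c := c) hn m hF k
  rw [setInterpolant, realInterpolant,
    (measureAverage_spec hn c (hreg _) (hreg _) (weight_mem_Icc _)).2.1,
    ← measureReal_refineSets_iterate (c := c) hn hm hF]

theorem exists_isSetLimit (hn : 1 ≤ n) {m : ℕ} (hm : 1 ≤ m) (c : AverageChoices n)
    (hF : ∀ i, RegularJordan (F i)) : ∃ Finf, IsSetLimit c m F Finf := by
  have hlim : ∀ x : ℝ, ∃ T, LebesgueFinite T ∧
      Tendsto (fun k => dMu (setInterpolant c m F k x) T) atTop (𝓝 0) := by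
    intro x
    have hreg := fun k => regularJordan_setInterpolant hn m c hF k x
    obtain ⟨C, hC⟩ := exists_setDist_setInterpolant_le hn hm c hF x
    exact exists_tendsto_dMu (fun k => (hreg k).isClosed.measurableSet)
      (fun k => (hreg k).measure_ne_top) hC
  choose Finf h using hlim
  exact ⟨Finf, h⟩

/-- Convergence of the real scheme needs no separate argument: its interpolants are the measures of
the set interpolants. -/
theorem IsSetLimit.isRealLimit (hn : 1 ≤ n) {m : ℕ} (hm : 1 ≤ m)
    (hF : ∀ i, RegularJordan (F i)) {Finf : ℝ → Set (E n)} (h : IsSetLimit c m F Finf) :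
    IsRealLimit m (fun i => volume.real (F i)) (fun x => volume.real (Finf x)) := by
  intro x
  simp_rw [← measureReal_setInterpolant (c := c) hn hm hF]
  exact tendsto_measureReal_of_tendsto_dMu
    (fun k => (regularJordan_setInterpolant hn m c hF k x).measure_ne_top) (h x).1.2.ne (h x).2

end Comparison

end SetSpline

theorem corollary5p5 (n : ℕ) (hn : 1 ≤ n) (m : ℕ) (hm : 1 ≤ m)
    (c : SetSpline.AverageChoices n)
    (F0 : ℤ → Set (EuclideanSpace ℝ (Fin n))) (hF0 : ∀ i, SetSpline.RegularJordan (F0 i)) :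
    (∃ Finf, SetSpline.IsSetLimit c m F0 Finf) ∧
    (∃ finf, SetSpline.IsRealLimit m (fun i => MeasureTheory.volume.real (F0 i)) finf) ∧
    ∀ Finf finf, SetSpline.IsSetLimit c m F0 Finf →
      SetSpline.IsRealLimit m (fun i => MeasureTheory.volume.real (F0 i)) finf →
      ∀ x, MeasureTheory.volume.real (Finf x) = finf x := by
  obtain ⟨Finf, hFinf⟩ := SetSpline.exists_isSetLimit hn hm c hF0
  refine ⟨⟨Finf, hFinf⟩, ⟨_, hFinf.isRealLimit hn hm hF0⟩, fun G g hG hg x => ?_⟩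
  exact tendsto_nhds_unique (hG.isRealLimit hn hm hF0 x) (hg x)
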